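/- Let $\mathbb{K}$ be a field, let $n\le 5$, and let $S=\mathbb{K}[x_1,\ldots,x_n]$ with the standard grading. For a monomial ideal $I\subseteq S$ let $\beta_{i,j}(I)$ denote its graded Betti numbers, i.e. the number of summands $S(-\mathbf a)$ with $|\mathbf a|=j$ in the $i$-th free module $F_i$ of the minimal multigraded free resolution $\cdots\to F_1\to F_0\to I\to 0$. Say that $I$ is $r$-step linear if, for some $d$, $I$ is generated by homogeneous elements of degree $d$ and $\beta_{i,j}(I)=0$ for all $0\le i\le r$ and all $j$ with $j-i>d$, and put $$\mathrm{index}(I)=\sup\{r\ge 0 : I\text{ is } r\text{-step linear}\}+1\in\mathbb{N}\cup\{\infty\},$$ where $\sup\varnothing=0$. Theorem. If $I\subseteq\mathbb{K}[x_1,\ldots,x_n]$, $n\le5$, is a square-free monomial ideal with $\mathrm{index}(I)>1$, then $\mathrm{index}(I^k)>1$ for all $k\ge1$. -/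

import Mathlib

namespace GLIndex

open MvPolynomial

/-- `I` is a square-free monomial ideal of `K[x_1, …, x_n]`: it is generated by some set of
square-free monomials `∏_{i ∈ F} x_i`. -/
def IsSquarefreeMonomialIdeal {K : Type*} [Field K] {n : ℕ}
    (I : Ideal (MvPolynomial (Fin n) K)) : Prop :=
  ∃ A : Set (Finset (Fin n)),
    I = Ideal.span ((fun F : Finset (Fin n) => ∏ i ∈ F, (X i : MvPolynomial (Fin n) K)) '' A)

/-- In the free module `⨁_b S(-δ b)`, where the basis vector `e_b` has multidegree `δ b`, the
vector `v = (v_b)_b` is multihomogeneous of multidegree `a`: every monomial `x^e e_b` occurring in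
it satisfies `e + δ b = a`. -/
def IsMultihomogeneous {K : Type*} [Field K] {n m : ℕ} (δ : Fin m → (Fin n →₀ ℕ))
    (a : Fin n →₀ ℕ) (v : Fin m → MvPolynomial (Fin n) K) : Prop :=
  ∀ b, ∀ e ∈ (v b).support, e + δ b = a

/-- A minimal multigraded free resolution `⋯ → F_2 → F_1 → F_0 → I → 0` of an ideal `I` of
`S = K[x_1, …, x_n]`, where `F_i = ⨁_b S(-deg i b)` is free of finite rank `rank i`. -/
structure MinimalFreeResolution {K : Type*} [Field K] {n : ℕ}
    (I : Ideal (MvPolynomial (Fin n) K)) where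
  /-- The rank of `F_i`. -/
  rank : ℕ → ℕ
  /-- The multidegree of the `b`-th basis vector of `F_i`. -/
  deg : (i : ℕ) → Fin (rank i) → (Fin n →₀ ℕ)
  /-- The augmentation `F_0 → I ⊆ S`. -/
  aug : (Fin (rank 0) → MvPolynomial (Fin n) K) →ₗ[MvPolynomial (Fin n) K]
    MvPolynomial (Fin n) K
  /-- The differential `F_{i+1} → F_i`. -/
  d : (i : ℕ) → (Fin (rank (i + 1)) → MvPolynomial (Fin n) K) →ₗ[MvPolynomial (Fin n) K]
    (Fin (rank i) → MvPolynomial (Fin n) K)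
  /-- The augmentation maps onto `I`. -/
  range_aug : LinearMap.range aug = I
  /-- Exactness at `F_0`. -/
  exact_zero : LinearMap.range (d 0) = LinearMap.ker aug
  /-- Exactness at `F_{i+1}`. -/
  exact_succ : ∀ i, LinearMap.range (d (i + 1)) = LinearMap.ker (d i)
  /-- The augmentation preserves multidegrees. -/
  aug_homogeneous : ∀ b, ∀ e ∈ (aug (Pi.single b 1)).support, e = deg 0 b
  /-- The differentials preserve multidegrees. -/
  d_homogeneous : ∀ i b, IsMultihomogeneous (deg i) (deg (i + 1) b) (d i (Pi.single b 1))
  /-- Minimality: the image of `F_{i+1}` lies in `(x_1, …, x_n) F_i`. -/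
  minimal : ∀ i v b, constantCoeff (d i v b) = 0

/-- The multigraded Betti number `β_{i,a}`: the number of summands `S(-a)` of `F_i`. -/
def MinimalFreeResolution.multigradedBetti {K : Type*} [Field K] {n : ℕ}
    {I : Ideal (MvPolynomial (Fin n) K)} (F : MinimalFreeResolution I)
    (i : ℕ) (a : Fin n →₀ ℕ) : ℕ :=
  (Finset.univ.filter fun b : Fin (F.rank i) => F.deg i b = a).card

/-- The graded Betti number `β_{i,j} = ∑_{|a| = j} β_{i,a}`, a finite sum over the
`a ∈ ℕ^n` with `|a| = j`. -/
def MinimalFreeResolution.gradedBetti {K : Type*} [Field K] {n : ℕ}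
    {I : Ideal (MvPolynomial (Fin n) K)} (F : MinimalFreeResolution I) (i j : ℕ) : ℕ :=
  ∑ a ∈ Finset.finsuppAntidiag (Finset.univ : Finset (Fin n)) j, F.multigradedBetti i a

/-- `I` is `r`-step linear: for some `d` it is generated by homogeneous elements of degree `d`,
and `β_{i,j}(I) = 0` for all `0 ≤ i ≤ r` and `j - i > d`. The Betti numbers are read off from a
minimal multigraded free resolution; it is unique up to isomorphism, so that the choice of the
resolution is immaterial. -/
def IsStepLinear {K : Type*} [Field K] {n : ℕ}
    (I : Ideal (MvPolynomial (Fin n) K)) (r : ℕ) : Prop :=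
  ∃ d : ℕ,
    (∃ G : Set (MvPolynomial (Fin n) K), (∀ f ∈ G, f.IsHomogeneous d) ∧ I = Ideal.span G) ∧
    ∃ F : MinimalFreeResolution I, ∀ i ≤ r, ∀ j, d + i < j → F.gradedBetti i j = 0

/-- The Green-Lazarsfeld index `sup {r : I is r-step linear} + 1`, with values in `ℕ ∪ {∞}`. -/
noncomputable def index {K : Type*} [Field K] {n : ℕ}
    (I : Ideal (MvPolynomial (Fin n) K)) : ℕ∞ :=
  sSup ((fun r : ℕ => (r : ℕ∞)) '' {r : ℕ | IsStepLinear I r}) + 1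

end GLIndex

namespace GLIndex

open MvPolynomial

/-! For an ideal generated by monomials of one degree, the first syzygies are linear exactly when
any two generators u, v are joined by a path of generators dividing lcm(u, v), each step replacing
one variable by another (`Linked`). Indeed a linear syzygy only relates generators that differ by
one replacement, so without such a path the syzygy between u and v could not be generated
(`MinimalFreeResolution.linked`); conversely, telescoping along paths writes every syzygy through
linear ones (`ker_le_span_linear`). The theorem thus becomes combinatorial: linkedness must pass
from the exponent set M to its k-fold sums.

With at most five variables, the degree d or the codegree n - d of the square-free generators is at
most two. Complementation in the all-ones vector t, and in k • t for the sums, swaps joins and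
meets, so large d amounts to the dual property `CoLinked` in degree n - d. Degrees zero and one are
easy. In degree two M is the edge set of a graph, and a sum is the degree vector of a multigraph.
For a red and a blue multigraph, alternating trails give either an exchange moving one vector
towards the other, or two disjoint trails, one with red end edges at p, p' and one with blue end
edges at q, q' (`IsEdgeSet.exchange_or_trails`). If M is linked, the graph has no gap, and an edge
between the trails produces an exchange after all. If M is co-linked, a unit-step path between the
first edges of the trails trades p, p' for q, q' without going below the meet. -/

/-! ### Unit-step paths and exchange -/

/-- The exponent vector of the variable `x_i`. -/
noncomputable def ev {σ : Type*} (i : σ) : σ →₀ ℕ := Finsupp.single i 1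

theorem ev_apply {σ : Type*} [DecidableEq σ] (i j : σ) : ev i j = if i = j then 1 else 0 := by
  simp [ev, Finsupp.single_apply]

@[simp] theorem degree_ev {σ : Type*} (i : σ) : (ev i).degree = 1 := by
  simp [ev]

/-- `c'` arises from `c` by replacing one variable by another one. -/
def UnitStep {σ : Type*} (c c' : σ →₀ ℕ) : Prop := ∃ p q, c' + ev p = c + ev q

/-- There is a path of unit steps from `a` to `b` all of whose later vertices lie in `N`. -/
def PathIn {σ : Type*} (N : Set (σ →₀ ℕ)) : (σ →₀ ℕ) → (σ →₀ ℕ) → Prop :=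
  Relation.ReflTransGen fun c c' => c' ∈ N ∧ UnitStep c c'

/-- Any two elements of `M` are connected by a path of unit steps in `M` below their join. -/
def Linked {σ : Type*} (M : Set (σ →₀ ℕ)) : Prop :=
  ∀ a ∈ M, ∀ b ∈ M, PathIn (M ∩ Set.Iic (a ⊔ b)) a b

/-- Any two elements of `M` are connected by a path of unit steps in `M` above their meet. -/
def CoLinked {σ : Type*} (M : Set (σ →₀ ℕ)) : Prop :=
  ∀ a ∈ M, ∀ b ∈ M, PathIn (M ∩ Set.Ici (a ⊓ b)) a b

/-- Of any two distinct elements of `M`, one can be moved towards the other by a unit step. -/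
def HasExchange {σ : Type*} (M : Set (σ →₀ ℕ)) : Prop :=
  ∀ a ∈ M, ∀ b ∈ M, a ≠ b → ∃ p q, b p < a p ∧ a q < b q ∧
    ((∃ c ∈ M, c + ev p = a + ev q) ∨ ∃ c ∈ M, c + ev q = b + ev p)

theorem PathIn.mono {σ : Type*} {N N' : Set (σ →₀ ℕ)} {a b : σ →₀ ℕ} (hN : N ⊆ N')
    (h : PathIn N a b) : PathIn N' a b :=
  Relation.ReflTransGen.mono (fun _ _ h => ⟨hN h.1, h.2⟩) _ _ h

theorem PathIn.trans {σ : Type*} {N : Set (σ →₀ ℕ)} {a b c : σ →₀ ℕ}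
    (h : PathIn N a b) (h' : PathIn N b c) : PathIn N a c :=
  Relation.ReflTransGen.trans h h'

theorem PathIn.single {σ : Type*} {N : Set (σ →₀ ℕ)} {a b : σ →₀ ℕ} (hb : b ∈ N)
    (h : UnitStep a b) : PathIn N a b :=
  Relation.ReflTransGen.single ⟨hb, h⟩

theorem PathIn.map {σ τ : Type*} {N : Set (σ →₀ ℕ)} {N' : Set (τ →₀ ℕ)}
    (f : (σ →₀ ℕ) → (τ →₀ ℕ)) {a b : σ →₀ ℕ} (ha : a ∈ N)
    (hf : ∀ c ∈ N, f c ∈ N') (hs : ∀ c ∈ N, ∀ c' ∈ N, UnitStep c c' → UnitStep (f c) (f c'))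
    (h : PathIn N a b) : PathIn N' (f a) (f b) := by
  have : b ∈ N ∧ PathIn N' (f a) (f b) := by
    induction h with
    | refl => exact ⟨ha, .refl⟩
    | tail _ hs' ih => exact ⟨hs'.1, ih.2.tail ⟨hf _ hs'.1, hs _ ih.1 _ hs'.1 hs'.2⟩⟩
  exact this.2

theorem PathIn.of_subsingleton {σ : Type*} {M N : Set (σ →₀ ℕ)} (hM : M.Subsingleton)
    {a b : σ →₀ ℕ} (ha : a ∈ M) (hb : b ∈ M) : PathIn N a b := by
  rw [hM ha hb]
  exact .refl

/-- If some element can always be moved strictly towards another one inside `N`, then `N` is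
path connected. -/
theorem pathIn_of_descent {σ : Type*} {N : Set (σ →₀ ℕ)}
    (h : ∀ a ∈ N, ∀ b ∈ N, a ≠ b → ∃ c ∈ N,
      (PathIn N a c ∧ (c - b).degree < (a - b).degree) ∨
      (PathIn N c b ∧ (a - c).degree < (a - b).degree))
    {a b : σ →₀ ℕ} (ha : a ∈ N) (hb : b ∈ N) : PathIn N a b := by
  induction hm : (a - b).degree using Nat.strong_induction_on generalizing a b with
  | _ m ih =>
    by_cases hab : a = b
    · rw [hab]; exact .refl
    · obtain ⟨c, hc, ⟨h1, h2⟩ | ⟨h1, h2⟩⟩ := h a ha b hb hab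
      · exact h1.trans (ih _ (hm ▸ h2) hc hb rfl)
      · exact (ih _ (hm ▸ h2) ha hc rfl).trans h1

/-- Subtraction is truncated, so `(a - b).degree` is the total excess of `a` over `b`. The move
removes one unit of excess at `p` and creates none at `q`, where `a` is still too small. -/
theorem degree_sub_lt_of_move_left {σ : Type*} {a b c : σ →₀ ℕ} {p q : σ} (hp : b p < a p)
    (hq : a q < b q) (hc : c + ev p = a + ev q) : (c - b).degree < (a - b).degree := by
  classical
  have : a - b = (c - b) + ev p := by
    ext i
    have := DFunLike.congr_fun hc i
    simp only [Finsupp.add_apply, Finsupp.tsub_apply, ev_apply] at this ⊢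
    grind
  rw [this, map_add, degree_ev]
  omega

theorem degree_sub_lt_of_move_right {σ : Type*} {a b c : σ →₀ ℕ} {p q : σ} (hp : b p < a p)
    (hq : a q < b q) (hc : c + ev q = b + ev p) : (a - c).degree < (a - b).degree := by
  classical
  have : a - b = (a - c) + ev p := by
    ext i
    have := DFunLike.congr_fun hc i
    simp only [Finsupp.add_apply, Finsupp.tsub_apply, ev_apply] at this ⊢
    grind
  rw [this, map_add, degree_ev]
  omega

theorem mem_Icc_of_move {σ : Type*} {a b c : σ →₀ ℕ} {p q : σ} (hp : b p < a p)
    (hq : a q < b q) (hc : c + ev p = a + ev q) : c ∈ Set.Icc (a ⊓ b) (a ⊔ b) := by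
  classical
  constructor <;>
  · intro i
    have := DFunLike.congr_fun hc i
    simp only [Finsupp.add_apply, Finsupp.inf_apply, Finsupp.sup_apply, ev_apply] at this ⊢
    grind

/-- Every exchange stays between meet and join and lowers the excess. Since steps are reversible,
the path may grow from either end, so it does not matter which of the two vectors can be moved. -/
theorem HasExchange.pathIn {σ : Type*} {M : Set (σ →₀ ℕ)} (hM : HasExchange M)
    {a b : σ →₀ ℕ} (ha : a ∈ M) (hb : b ∈ M) :
    PathIn (M ∩ Set.Icc (a ⊓ b) (a ⊔ b)) a b := by
  refine pathIn_of_descent ?_ ⟨ha, inf_le_left, le_sup_left⟩ ⟨hb, inf_le_right, le_sup_right⟩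
  intro u hu v hv huv
  have hsub : Set.Icc (u ⊓ v) (u ⊔ v) ⊆ Set.Icc (a ⊓ b) (a ⊔ b) :=
    Set.Icc_subset_Icc (le_inf hu.2.1 hv.2.1) (sup_le hu.2.2 hv.2.2)
  obtain ⟨p, q, hp, hq, ⟨c, hcM, hc⟩ | ⟨c, hcM, hc⟩⟩ := hM u hu.1 v hv.1 huv
  · have hcN := hsub (mem_Icc_of_move hp hq hc)
    exact ⟨c, ⟨hcM, hcN⟩, .inl ⟨.single ⟨hcM, hcN⟩ ⟨p, q, hc⟩,
      degree_sub_lt_of_move_left hp hq hc⟩⟩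
  · have hcN := mem_Icc_of_move hq hp hc
    rw [inf_comm, sup_comm] at hcN
    exact ⟨c, ⟨hcM, hsub hcN⟩, .inr ⟨.single hv ⟨p, q, hc.symm⟩,
      degree_sub_lt_of_move_right hp hq hc⟩⟩

theorem HasExchange.linked {σ : Type*} {M : Set (σ →₀ ℕ)} (hM : HasExchange M) : Linked M :=
  fun _ ha _ hb => (hM.pathIn ha hb).mono fun _ h => ⟨h.1, h.2.2⟩

theorem HasExchange.coLinked {σ : Type*} {M : Set (σ →₀ ℕ)} (hM : HasExchange M) :
    CoLinked M :=
  fun _ ha _ hb => (hM.pathIn ha hb).mono fun _ h => ⟨h.1, h.2.1⟩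

theorem exists_lt_of_degree_le {σ : Type*} {a b : σ →₀ ℕ} (hab : a ≠ b)
    (hd : b.degree ≤ a.degree) : ∃ p, b p < a p := by
  by_contra! h
  have hle : a ≤ b := h
  obtain ⟨c, rfl⟩ := exists_add_of_le hle
  rw [map_add] at hd
  have : c.degree = 0 := by omega
  rw [Finsupp.degree_eq_zero_iff] at this
  simp [this] at hab

/-! ### Sums of `k` exponent vectors -/

/-- The sums of `k` elements of `M`. -/
def kSums {σ : Type*} (M : Set (σ →₀ ℕ)) : ℕ → Set (σ →₀ ℕ)
  | 0 => {0}
  | k + 1 => {a | ∃ b ∈ kSums M k, ∃ m ∈ M, a = b + m}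

theorem degree_of_mem_kSums {σ : Type*} {M : Set (σ →₀ ℕ)} {d : ℕ}
    (hM : ∀ m ∈ M, m.degree = d) {k : ℕ} {a : σ →₀ ℕ} (ha : a ∈ kSums M k) :
    a.degree = k * d := by
  induction k generalizing a with
  | zero => simp [show a = 0 from ha]
  | succ k ih =>
    obtain ⟨b, hb, m, hm, rfl⟩ := ha
    rw [map_add, ih hb, hM m hm]
    ring

theorem exists_mem_kSums {σ : Type*} {M : Set (σ →₀ ℕ)} {a : σ →₀ ℕ}
    (ha : a ∈ AddSubmonoid.closure M) : ∃ k, a ∈ kSums M k := by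
  induction ha using AddSubmonoid.closure_induction_right with
  | zero => exact ⟨0, rfl⟩
  | add_right x _ y hy ih =>
    obtain ⟨k, hk⟩ := ih
    exact ⟨k + 1, x, hk, y, hy, rfl⟩

/-- The `k`-fold sums of elements of a set of vectors of degree `d > 0` are the elements of degree
`k * d` of the submonoid it generates. -/
theorem mem_kSums_iff {σ : Type*} {M : Set (σ →₀ ℕ)} {d : ℕ} (hd : 0 < d)
    (hM : ∀ m ∈ M, m.degree = d) {k : ℕ} {a : σ →₀ ℕ} :
    a ∈ kSums M k ↔ a ∈ AddSubmonoid.closure M ∧ a.degree = k * d := by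
  constructor
  · intro ha
    refine ⟨?_, degree_of_mem_kSums hM ha⟩
    induction k generalizing a with
    | zero => rw [show a = 0 from ha]; exact zero_mem _
    | succ k ih =>
      obtain ⟨b, hb, m, hm, rfl⟩ := ha
      exact add_mem (ih hb) (AddSubmonoid.subset_closure hm)
  · rintro ⟨ha, hk⟩
    obtain ⟨l, hl⟩ := exists_mem_kSums ha
    rw [degree_of_mem_kSums hM hl] at hk
    rwa [← Nat.eq_of_mul_eq_mul_right hd hk]

theorem kSums_subsingleton {σ : Type*} {M : Set (σ →₀ ℕ)} (hM : M.Subsingleton) (k : ℕ) :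
    (kSums M k).Subsingleton := by
  induction k with
  | zero => exact Set.subsingleton_singleton
  | succ k ih =>
    rintro _ ⟨b, hb, m, hm, rfl⟩ _ ⟨b', hb', m', hm', rfl⟩
    rw [ih hb hb', hM hm hm']

theorem linked_of_subsingleton {σ : Type*} {M : Set (σ →₀ ℕ)} (hM : M.Subsingleton) :
    Linked M :=
  fun _ ha _ hb => .of_subsingleton hM ha hb

theorem kSums_empty {σ : Type*} {k : ℕ} (hk : 1 ≤ k) :
    kSums (∅ : Set (σ →₀ ℕ)) k = ∅ := by
  obtain ⟨k, rfl⟩ := Nat.exists_eq_add_of_le' hk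
  ext
  simp [kSums]

/-! ### Complements -/

theorem UnitStep.of_complement {σ : Type*} {t c c' d d' : σ →₀ ℕ} (h : UnitStep c c')
    (hd : c + d = t) (hd' : c' + d' = t) : UnitStep d d' := by
  obtain ⟨p, q, h⟩ := h
  refine ⟨q, p, ?_⟩
  have h1 : c + (c' + d' + ev q) = c + (c' + (d + ev p)) :=
    calc c + (c' + d' + ev q) = (c' + d') + (c + ev q) := by abel
      _ = (c + d) + (c' + ev p) := by rw [hd, hd', h]
      _ = _ := by abel
  have h2 := add_left_cancel h1
  rw [add_assoc] at h2
  exact add_left_cancel h2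

/-- The complements of the elements of `M` with respect to `t`. -/
def complement {σ : Type*} (t : σ →₀ ℕ) (M : Set (σ →₀ ℕ)) : Set (σ →₀ ℕ) :=
  {a | ∃ b ∈ M, a + b = t}

theorem complement_complement {σ : Type*} {t : σ →₀ ℕ} {M : Set (σ →₀ ℕ)}
    (hM : ∀ m ∈ M, m ≤ t) : complement t (complement t M) = M := by
  ext a
  constructor
  · rintro ⟨b, ⟨c, hc, hb⟩, ha⟩
    rw [add_comm] at ha
    rwa [add_left_cancel (ha.trans hb.symm)]
  · intro ha
    obtain ⟨b, hb⟩ := exists_add_of_le (hM a ha)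
    exact ⟨b, ⟨a, ha, by rw [hb, add_comm]⟩, hb.symm⟩

theorem le_of_mem_complement {σ : Type*} {t : σ →₀ ℕ} {M : Set (σ →₀ ℕ)}
    {a : σ →₀ ℕ} (ha : a ∈ complement t M) : a ≤ t := by
  obtain ⟨b, -, rfl⟩ := ha
  exact le_self_add

theorem le_of_mem_kSums {σ : Type*} {t : σ →₀ ℕ} {M : Set (σ →₀ ℕ)}
    (hM : ∀ m ∈ M, m ≤ t) {k : ℕ} {a : σ →₀ ℕ} (ha : a ∈ kSums M k) : a ≤ k • t := by
  induction k generalizing a with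
  | zero => simp [show a = 0 from ha]
  | succ k ih =>
    obtain ⟨b, hb, m, hm, rfl⟩ := ha
    rw [succ_nsmul]
    exact add_le_add (ih hb) (hM m hm)

theorem kSums_complement {σ : Type*} {t : σ →₀ ℕ} {M : Set (σ →₀ ℕ)}
    (hM : ∀ m ∈ M, m ≤ t) (k : ℕ) :
    kSums (complement t M) k = complement (k • t) (kSums M k) := by
  induction k with
  | zero =>
    ext a
    simp [kSums, complement]
  | succ k ih =>
    ext a
    constructor
    · rintro ⟨b, hb, m, ⟨m', hm', hm⟩, rfl⟩
      rw [ih] at hb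
      obtain ⟨b', hb', hbk⟩ := hb
      refine ⟨b' + m', ⟨b', hb', m', hm', rfl⟩, ?_⟩
      rw [succ_nsmul, ← hbk, ← hm]
      abel
    · rintro ⟨_, ⟨b', hb', m', hm', rfl⟩, ha⟩
      obtain ⟨m, hm⟩ := exists_add_of_le (hM m' hm')
      obtain ⟨b, hb⟩ := exists_add_of_le (le_of_mem_kSums hM hb')
      refine ⟨b, ih ▸ ⟨b', hb', by rw [hb, add_comm]⟩, m, ⟨m', hm', by rw [hm, add_comm]⟩, ?_⟩
      rw [succ_nsmul, hb, hm] at ha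
      exact add_right_cancel (ha.trans (by abel : _ = b + m + (b' + m')))

theorem unitStep_tsub {σ : Type*} {t c c' : σ →₀ ℕ} (hc : c ≤ t) (hc' : c' ≤ t)
    (h : UnitStep c c') : UnitStep (t - c) (t - c') :=
  h.of_complement (add_tsub_cancel_of_le hc) (add_tsub_cancel_of_le hc')

theorem tsub_mem_complement {σ : Type*} {t c : σ →₀ ℕ} {M : Set (σ →₀ ℕ)} (hc : c ≤ t)
    (h : c ∈ M) : t - c ∈ complement t M :=
  ⟨c, h, tsub_add_cancel_of_le hc⟩

/-- The map `c ↦ t - c` reverses the order, so it turns bounds by the join into bounds by the meet,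
and it preserves unit steps. -/
theorem Linked.complement {σ : Type*} {t : σ →₀ ℕ} {M : Set (σ →₀ ℕ)} (hM : ∀ m ∈ M, m ≤ t)
    (h : Linked M) : CoLinked (complement t M) := by
  rintro a ⟨a', ha', ha⟩ b ⟨b', hb', hb⟩
  have ha1 : t - a' = a := by rw [← ha, add_tsub_cancel_right]
  have hb1 : t - b' = b := by rw [← hb, add_tsub_cancel_right]
  rw [← ha1, ← hb1]
  refine (h a' ha' b' hb').map (N := M ∩ Set.Iic (a' ⊔ b'))
    (N' := GLIndex.complement t M ∩ Set.Ici _)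
    (fun c => t - c) ⟨ha', Set.mem_Iic.2 le_sup_left⟩ ?_ ?_
  · intro c hc
    refine ⟨tsub_mem_complement (hM c hc.1) hc.1, fun i => ?_⟩
    have h1 := hc.2 i
    simp only [Finsupp.inf_apply, Finsupp.sup_apply, Finsupp.tsub_apply] at *
    grind
  · intro c hc c' hc' hs
    exact unitStep_tsub (hM c hc.1) (hM c' hc'.1) hs

theorem CoLinked.complement {σ : Type*} {t : σ →₀ ℕ} {M : Set (σ →₀ ℕ)} (hM : ∀ m ∈ M, m ≤ t)
    (h : CoLinked M) : Linked (complement t M) := by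
  rintro a ⟨a', ha', ha⟩ b ⟨b', hb', hb⟩
  have ha1 : t - a' = a := by rw [← ha, add_tsub_cancel_right]
  have hb1 : t - b' = b := by rw [← hb, add_tsub_cancel_right]
  rw [← ha1, ← hb1]
  refine (h a' ha' b' hb').map (N := M ∩ Set.Ici (a' ⊓ b'))
    (N' := GLIndex.complement t M ∩ Set.Iic _)
    (fun c => t - c) ⟨ha', Set.mem_Ici.2 inf_le_left⟩ ?_ ?_
  · intro c hc
    refine ⟨tsub_mem_complement (hM c hc.1) hc.1, fun i => ?_⟩
    have h1 := hc.2 i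
    simp only [Finsupp.inf_apply, Finsupp.sup_apply, Finsupp.tsub_apply] at *
    grind
  · intro c hc c' hc' hs
    exact unitStep_tsub (hM c hc.1) (hM c' hc'.1) hs

/-! ### Splitting off a generator; sums of variables -/

theorem exists_add_of_mem_closure {σ : Type*} {M : Set (σ →₀ ℕ)} {a : σ →₀ ℕ}
    (ha : a ∈ AddSubmonoid.closure M) {p : σ} (hp : 0 < a p) :
    ∃ m ∈ M, 0 < m p ∧ ∃ b ∈ AddSubmonoid.closure M, a = b + m := by
  induction ha using AddSubmonoid.closure_induction_right with
  | zero => simp at hp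
  | add_right x hx y hy ih =>
    by_cases hyp : 0 < y p
    · exact ⟨y, hy, hyp, x, hx, rfl⟩
    · have hxp : 0 < x p := by
        rw [Finsupp.add_apply] at hp
        omega
      obtain ⟨m, hm, hmp, b, hb, rfl⟩ := ih hxp
      exact ⟨m, hm, hmp, b + y, add_mem hb (AddSubmonoid.subset_closure hy),
        add_right_comm _ _ _⟩

theorem hasExchange_kSums_of_variables {σ : Type*} {M : Set (σ →₀ ℕ)}
    (hM : ∀ m ∈ M, ∃ x, m = ev x) (k : ℕ) : HasExchange (kSums M k) := by
  classical
  have hdeg : ∀ m ∈ M, m.degree = 1 := by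
    intro m hm
    obtain ⟨x, rfl⟩ := hM m hm
    simp
  have key : ∀ a ∈ AddSubmonoid.closure M, ∀ p, 0 < a p →
      ev p ∈ M ∧ ∃ b ∈ AddSubmonoid.closure M, a = b + ev p := by
    intro a ha p hp
    obtain ⟨m, hm, hmp, b, hb, rfl⟩ := exists_add_of_mem_closure ha hp
    obtain ⟨x, rfl⟩ := hM m hm
    have : x = p := by
      by_contra h
      simp [ev_apply, h] at hmp
    subst this
    exact ⟨hm, b, hb, rfl⟩
  intro a ha b hb hab
  rw [mem_kSums_iff one_pos hdeg] at ha hb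
  obtain ⟨p, hp⟩ := exists_lt_of_degree_le hab (hb.2.trans ha.2.symm).le
  obtain ⟨q, hq⟩ := exists_lt_of_degree_le hab.symm (ha.2.trans hb.2.symm).le
  obtain ⟨-, c, hc, rfl⟩ := key a ha.1 p (by omega)
  refine ⟨p, q, hp, hq, .inl ⟨c + ev q, ?_, add_right_comm _ _ _⟩⟩
  rw [mem_kSums_iff one_pos hdeg]
  refine ⟨add_mem hc (AddSubmonoid.subset_closure (key b hb.1 q (by omega)).1), ?_⟩
  simpa using ha.2

/-! ### Edge sets and alternating trails -/

/-- `M` is the set of exponents of the edge ideal of a graph. -/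
def IsEdgeSet {σ : Type*} (M : Set (σ →₀ ℕ)) : Prop :=
  ∀ m ∈ M, ∃ x y, x ≠ y ∧ m = ev x + ev y

theorem IsEdgeSet.degree {σ : Type*} {M : Set (σ →₀ ℕ)} (hM : IsEdgeSet M) :
    ∀ m ∈ M, m.degree = 2 := by
  intro m hm
  obtain ⟨x, y, -, rfl⟩ := hM m hm
  simp

theorem IsEdgeSet.exists_edge {σ : Type*} {M : Set (σ →₀ ℕ)} (hM : IsEdgeSet M)
    {a : σ →₀ ℕ} (ha : a ∈ AddSubmonoid.closure M) {p : σ} (hp : 0 < a p) :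
    ∃ x, x ≠ p ∧ ev p + ev x ∈ M ∧ ∃ b ∈ AddSubmonoid.closure M, a = b + (ev p + ev x) := by
  classical
  obtain ⟨m, hm, hmp, b, hb, rfl⟩ := exists_add_of_mem_closure ha hp
  obtain ⟨x, y, hxy, rfl⟩ := hM m hm
  by_cases hxp : x = p
  · subst hxp
    exact ⟨y, hxy.symm, hm, b, hb, rfl⟩
  · have : y = p := by
      by_contra h
      simp [ev_apply, h, hxp] at hmp
    subst this
    exact ⟨x, hxy, by rwa [add_comm], b, hb, by rw [add_comm (ev x)]⟩

/-- Let `a` and `b` be degree vectors of a red and a blue multigraph, and let `p` have a larger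
red than blue degree. Then an alternating trail starting with a red edge at `p` either ends with a
blue edge at some vertex `q` of larger blue degree, or with a red edge at some vertex `p'` of
larger red degree. Here `a₀` and `b₀` are the degree vectors of the red and blue parts of the
trail, and in the second case `w` is that of the red edges without the first edge `p x`. -/
theorem IsEdgeSet.alternating_trail {σ : Type*} {M : Set (σ →₀ ℕ)} (hM : IsEdgeSet M)
    {a b : σ →₀ ℕ} (ha : a ∈ AddSubmonoid.closure M) (hb : b ∈ AddSubmonoid.closure M)
    {p : σ} (hp : b p < a p) :
    (∃ q, a q < b q ∧ ∃ a₀ ∈ AddSubmonoid.closure M, ∃ b₀ ∈ AddSubmonoid.closure M,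
      ∃ a₁ ∈ AddSubmonoid.closure M, ∃ b₁ ∈ AddSubmonoid.closure M,
      a = a₀ + a₁ ∧ b = b₀ + b₁ ∧ a₀ + ev q = b₀ + ev p) ∨
    (∃ p' x, (b + ev p) p' < a p' ∧ ev p + ev x ∈ M ∧
      ∃ w ∈ AddSubmonoid.closure M, ∃ b₀ ∈ AddSubmonoid.closure M,
      ∃ a₁ ∈ AddSubmonoid.closure M, ∃ b₁ ∈ AddSubmonoid.closure M,
      a = w + (ev p + ev x) + a₁ ∧ b = b₀ + b₁ ∧ b₀ + ev p' = w + ev x) := by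
  classical
  induction hd : a.degree using Nat.strong_induction_on generalizing a b p with
  | _ d ih =>
    obtain ⟨x, hxp, hpx, a', ha', rfl⟩ := hM.exists_edge ha (by omega : 0 < a p)
    have hd' : a'.degree < d := by
      rw [map_add, map_add, degree_ev, degree_ev] at hd
      omega
    have hpx' := AddSubmonoid.subset_closure hpx
    -- The trail may already stop after its first edge. The margin `b + ev p` in the conclusion asks
    -- for red excess two when a trail ends where it began; here `x ≠ p`.
    by_cases hx : b x < (a' + (ev p + ev x)) x
    · refine .inr ⟨x, x, ?_, hpx, 0, zero_mem _, 0, zero_mem _, a', ha', b, hb, ?_, ?_, ?_⟩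
      · rw [Finsupp.add_apply, ev_apply, if_neg hxp.symm]
        exact hx
      · abel
      · abel
      · abel
    · obtain ⟨y, hyx, hxy, b', hb', rfl⟩ := hM.exists_edge hb (p := x) (by
        simp only [Finsupp.add_apply, ev_apply] at hx
        grind)
      have hxy' := AddSubmonoid.subset_closure hxy
      by_cases hyp : y = p
      -- The trail runs back along the same edge in the other colour. Both copies cancel in the
      -- comparison and are put into the unused remainders.
      · subst hyp
        have hp1 : b' y < a' y := by
          simp only [Finsupp.add_apply, ev_apply] at hp
          grind
        obtain ⟨q, hq, a₀, ha₀, b₀, hb₀, a₁, ha₁, b₁, hb₁, rfl, rfl, h⟩ |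
          ⟨p', x', hq, hx', w, hw, b₀, hb₀, a₁, ha₁, b₁, hb₁, rfl, rfl, h⟩ :=
          ih _ hd' ha' hb' hp1 rfl
        · refine .inl ⟨q, ?_, a₀, ha₀, b₀, hb₀, _, add_mem ha₁ hpx', _, add_mem hb₁ hxy',
            add_assoc _ _ _, add_assoc _ _ _, h⟩
          simp only [Finsupp.add_apply, ev_apply] at hq ⊢
          omega
        · refine .inr ⟨p', x', ?_, hx', w, hw, b₀, hb₀, _, add_mem ha₁ hpx', _,
            add_mem hb₁ hxy', add_assoc _ _ _, add_assoc _ _ _, h⟩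
          simp only [Finsupp.add_apply, ev_apply] at hq ⊢
          omega
      · by_cases hy : (a' + (ev p + ev x)) y < (b' + (ev x + ev y)) y
        · refine .inl ⟨y, hy, _, hpx', _, hxy', a', ha', b', hb', ?_, ?_, ?_⟩ <;> abel
        -- Blue has no excess at `y`, but one blue edge at `y` has been used up, so red has excess
        -- there in the remainder and the trail continues from `y`.
        · have hp1 : b' y < a' y := by
            simp only [Finsupp.add_apply, ev_apply] at hy
            grind
          obtain ⟨q, hq, a₀, ha₀, b₀, hb₀, a₁, ha₁, b₁, hb₁, rfl, rfl, h⟩ |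
            ⟨p', x', hq, hx', w, hw, b₀, hb₀, a₁, ha₁, b₁, hb₁, rfl, rfl, h⟩ :=
            ih _ hd' ha' hb' hp1 rfl
          · refine .inl ⟨q, ?_, _, add_mem ha₀ hpx', _, add_mem hb₀ hxy', a₁, ha₁, b₁, hb₁,
              ?_, ?_, ?_⟩
            · simp only [Finsupp.add_apply, ev_apply] at hq hp hy ⊢
              grind
            · abel
            · abel
            · calc _ = (a₀ + ev q) + (ev p + ev x) := by abel
                _ = _ := by rw [h]; abel
          · refine .inr ⟨p', x, ?_, hpx, w + (ev y + ev x'), add_mem hw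
              (AddSubmonoid.subset_closure hx'), _, add_mem hb₀ hxy', a₁, ha₁, b₁, hb₁,
              ?_, ?_, ?_⟩
            · simp only [Finsupp.add_apply, ev_apply] at hq hp hy ⊢
              grind
            · abel
            · abel
            · calc _ = (b₀ + ev p') + (ev x + ev y) := by abel
                _ = _ := by rw [h]; abel

/-- Two distinct degree vectors `a`, `b` of multigraphs with the same number of edges either admit
an exchange, or there are edge-disjoint alternating trails, one from `p` to `p'` beginning and
ending with an edge of `a`, and one from `q` to `q'` beginning and ending with an edge of `b`. -/
theorem IsEdgeSet.exchange_or_trails {σ : Type*} {M : Set (σ →₀ ℕ)} (hM : IsEdgeSet M)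
    {a b : σ →₀ ℕ} (ha : a ∈ AddSubmonoid.closure M) (hb : b ∈ AddSubmonoid.closure M)
    (hab : a ≠ b) (hdeg : a.degree = b.degree) :
    (∃ p q, b p < a p ∧ a q < b q ∧
      ((∃ c ∈ AddSubmonoid.closure M, c + ev p = a + ev q) ∨
        ∃ c ∈ AddSubmonoid.closure M, c + ev q = b + ev p)) ∨
    (∃ p p' x q q' z, b p < a p ∧ (b + ev p) p' < a p' ∧ a q < b q ∧ (a + ev q) q' < b q' ∧
      ev p + ev x ∈ M ∧ ev q + ev z ∈ M ∧
      ∃ w ∈ AddSubmonoid.closure M, ∃ u ∈ AddSubmonoid.closure M,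
      ∃ w' ∈ AddSubmonoid.closure M, ∃ u' ∈ AddSubmonoid.closure M,
      ∃ r ∈ AddSubmonoid.closure M,
      a = w + (ev p + ev x) + (u' + r) ∧ u + ev p' = w + ev x ∧ u' + ev q' = w' + ev z) := by
  classical
  obtain ⟨p, hp⟩ := exists_lt_of_degree_le hab hdeg.symm.le
  obtain ⟨q, hq⟩ := exists_lt_of_degree_le hab.symm hdeg.le
  obtain ⟨q', hq', a₀, ha₀, b₀, hb₀, a₁, ha₁, b₁, hb₁, rfl, rfl, h⟩ |
    ⟨p', x, hp', hpx, w, hw, u, hu, a₁, ha₁, b₁, hb₁, rfl, rfl, h⟩ :=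
    hM.alternating_trail ha hb hp
  -- Swapping the colours along the trail changes `a` only at its two ends.
  · refine .inl ⟨p, q', hp, hq', .inl ⟨b₀ + a₁, add_mem hb₀ ha₁, ?_⟩⟩
    calc _ = (b₀ + ev p) + a₁ := by abel
      _ = _ := by rw [← h]; abel
  · have hpt : ∀ i, (w + (ev p + ev x) + a₁) i = u i + ev p' i + ev p i + a₁ i := by
      intro i
      have := DFunLike.congr_fun h i
      simp only [Finsupp.add_apply] at this ⊢
      omega
    -- Removing the first trail takes at least as much from `a` as from `b` at every vertex, so the
    -- blue excess at `q` survives and a second trail, with colours exchanged, starts there.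
    have hq1 : a₁ q < b₁ q := by
      rw [hpt, Finsupp.add_apply] at hq
      omega
    obtain ⟨r, hr, b₂, hb₂, a₂, ha₂, b₃, hb₃, a₃, ha₃, rfl, rfl, h'⟩ |
      ⟨q', z, hq', hqz, w', hw', u', hu', b₃, hb₃, a₃, ha₃, rfl, rfl, h'⟩ :=
      hM.alternating_trail hb₁ ha₁ hq1
    · refine .inl ⟨r, q, ?_, hq, .inr ⟨u + (a₂ + b₃), add_mem hu (add_mem ha₂ hb₃), ?_⟩⟩
      · rw [hpt, Finsupp.add_apply]
        omega
      · calc _ = u + ((a₂ + ev q) + b₃) := by abel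
          _ = _ := by rw [← h']; abel
    · refine .inr ⟨p, p', x, q, q', z, hp, hp', hq, ?_, hpx, hqz, w, hw, u, hu, w', hw', u', hu',
        a₃, ha₃, rfl, h, h'⟩
      rw [hpt] at hp
      rw [Finsupp.add_apply, hpt] at hp' ⊢
      rw [Finsupp.add_apply] at hp hp' ⊢
      simp only [Finsupp.add_apply, ev_apply] at hp hp' hq' ⊢
      grind

/-- No two edges form a gap: they share a vertex or are joined by a third edge. -/
def IsGapFree {σ : Type*} (M : Set (σ →₀ ℕ)) : Prop :=
  ∀ p x q z, ev p + ev x ∈ M → ev q + ev z ∈ M →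
    p = q ∨ p = z ∨ x = q ∨ x = z ∨
      ev p + ev q ∈ M ∨ ev p + ev z ∈ M ∨ ev x + ev q ∈ M ∨ ev x + ev z ∈ M

/-- If no trail gives an exchange directly, gap-freeness applied to the first edges `p x` and `q z`
of the two trails yields an edge between them. Adding it to `a`, after recolouring the first trail
or just dropping `p x`, and recolouring the second trail or not, loses `p'` or `p` and gains `q'` or
`q`. The four possible joining edges match these four choices; shared vertices reduce to them. -/
theorem IsEdgeSet.hasExchange_kSums {σ : Type*} {M : Set (σ →₀ ℕ)} (hM : IsEdgeSet M)
    (hgap : IsGapFree M) (k : ℕ) : HasExchange (kSums M k) := by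
  classical
  have hmem {c a : σ →₀ ℕ} {p q : σ} (hc : c ∈ AddSubmonoid.closure M) (ha : a ∈ kSums M k)
      (h : c + ev p = a + ev q) : c ∈ kSums M k := by
    rw [mem_kSums_iff two_pos hM.degree] at ha ⊢
    refine ⟨hc, ?_⟩
    have := congrArg Finsupp.degree h
    simp only [map_add, degree_ev] at this
    omega
  intro a ha b hb hab
  have ha' := (mem_kSums_iff two_pos hM.degree).1 ha
  have hb' := (mem_kSums_iff two_pos hM.degree).1 hb
  obtain ⟨p, q, hp, hq, ⟨c, hc, h⟩ | ⟨c, hc, h⟩⟩ |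
    ⟨p, p', x, q, q', z, hp, hp', hq, hq', hpx, hqz, w, hw, u, hu, w', hw', u', hu', r, hr,
      hae, h, h'⟩ :=
    hM.exchange_or_trails ha'.1 hb'.1 hab (ha'.2.trans hb'.2.symm)
  · exact ⟨p, q, hp, hq, .inl ⟨c, hmem hc ha h, h⟩⟩
  · exact ⟨p, q, hp, hq, .inr ⟨c, hmem hc hb h, h⟩⟩
  · have hbp' : b p' < a p' := by
      rw [Finsupp.add_apply] at hp'
      omega
    have haq' : a q' < b q' := by
      rw [Finsupp.add_apply] at hq'
      omega
    have hpq : p ≠ q := by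
      rintro rfl
      omega
    have pq (hE : ev p + ev q ∈ M) : ∃ c ∈ AddSubmonoid.closure M, c + ev p' = a + ev q := by
      refine ⟨u + (ev p + ev q) + (u' + r), add_mem (add_mem hu (AddSubmonoid.subset_closure hE))
        (add_mem hu' hr), ?_⟩
      calc _ = (u + ev p') + (ev p + ev q) + (u' + r) := by abel
        _ = _ := by rw [h, hae]; abel
    have xq (hE : ev x + ev q ∈ M) : ∃ c ∈ AddSubmonoid.closure M, c + ev p = a + ev q := by
      refine ⟨w + (ev x + ev q) + (u' + r), add_mem (add_mem hw (AddSubmonoid.subset_closure hE))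
        (add_mem hu' hr), ?_⟩
      rw [hae]
      abel
    have conclude {s t : σ} (hs : b s < a s) (ht : a t < b t)
        (hc : ∃ c ∈ AddSubmonoid.closure M, c + ev s = a + ev t) :
        ∃ p q, b p < a p ∧ a q < b q ∧
          ((∃ c ∈ kSums M k, c + ev p = a + ev q) ∨ ∃ c ∈ kSums M k, c + ev q = b + ev p) := by
      obtain ⟨c, hc, hce⟩ := hc
      exact ⟨s, t, hs, ht, .inl ⟨c, hmem hc ha hce, hce⟩⟩
    obtain e | rfl | rfl | rfl | e | e | e | e := hgap p x q z hpx hqz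
    · exact absurd e hpq
    · exact conclude hbp' hq (pq (by rwa [add_comm]))
    · exact conclude hbp' hq (pq hpx)
    · exact conclude hp hq (xq (by rwa [add_comm]))
    · exact conclude hbp' hq (pq e)
    · refine conclude hbp' haq' ⟨u + (ev p + ev z) + (w' + r), add_mem (add_mem hu
        (AddSubmonoid.subset_closure e)) (add_mem hw' hr), ?_⟩
      calc _ = (u + ev p') + ev p + (w' + ev z) + r := by abel
        _ = _ := by rw [h, ← h', hae]; abel
    · exact conclude hp hq (xq e)
    · refine conclude hp haq' ⟨w + (ev x + ev z) + (w' + r), add_mem (add_mem hw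
        (AddSubmonoid.subset_closure e)) (add_mem hw' hr), ?_⟩
      calc _ = w + (ev p + ev x) + (w' + ev z) + r := by abel
        _ = _ := by rw [← h', hae]; abel

/-- A unit step from the edge `p x` below the join leads to an edge that keeps `p` or `x` and has
its ends among `p, x, q, z`. In a gap only `p x` itself qualifies, so no path leaves it. -/
theorem IsEdgeSet.isGapFree_of_linked {σ : Type*} {M : Set (σ →₀ ℕ)} (hM : IsEdgeSet M)
    (h : Linked M) : IsGapFree M := by
  classical
  intro p x q z hpx hqz
  by_contra! hcon
  obtain ⟨h1, h2, h3, h4, h5, h6, h7, h8⟩ := hcon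
  have hpath := h _ hpx _ hqz
  suffices hs : ∀ c, PathIn (M ∩ Set.Iic ((ev p + ev x) ⊔ (ev q + ev z))) (ev p + ev x) c →
      c = ev p + ev x by
    have := DFunLike.congr_fun (hs _ hpath) p
    simp only [Finsupp.add_apply, ev_apply] at this
    grind
  intro c hc
  induction hc with
  | refl => rfl
  | tail _ hs ih =>
    subst ih
    obtain ⟨⟨hcM, hle⟩, s, t, hst⟩ := hs
    obtain ⟨i, j, hij, rfl⟩ := hM _ hcM
    have hi := hle i
    have hj := hle j
    have hloop : ∀ v, ev v + ev v ∉ M := by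
      intro v hv
      obtain ⟨i', j', hij', e⟩ := hM _ hv
      have e1 := DFunLike.congr_fun e i'
      have e2 := DFunLike.congr_fun e j'
      simp only [Finsupp.add_apply, ev_apply] at e1 e2
      grind
    have hsi : ∀ v, (ev i + ev j + ev s : σ →₀ ℕ) v = (ev p + ev x + ev t : σ →₀ ℕ) v :=
      fun v => DFunLike.congr_fun hst v
    have hp1 := hsi p
    have hx1 := hsi x
    simp only [Finsupp.add_apply, Finsupp.sup_apply, ev_apply] at hi hj hp1 hx1
    have hi' : i = p ∨ i = x ∨ i = q ∨ i = z := by grind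
    have hj' : j = p ∨ j = x ∨ j = q ∨ j = z := by grind
    have hpx' : p ≠ x := by
      rintro rfl
      exact hloop _ hpx
    rcases hi' with rfl | rfl | rfl | rfl <;> rcases hj' with rfl | rfl | rfl | rfl <;>
      first
      | rfl
      | exact add_comm _ _
      | contradiction
      | grind

/-- In the case of two trails, recolouring the first writes `a = c + (ev p + ev p')`. Both `p` and
`p'` are excess, so `c` still lies above the meet and any edge may be added to it. The path goes
through `c` plus `p x`, then along a path in `M` to `c` plus `q z`, and ends at `c` plus `q + q'`,
which is closer to `b`. -/
theorem IsEdgeSet.coLinked_kSums {σ : Type*} {M : Set (σ →₀ ℕ)} (hM : IsEdgeSet M)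
    (hco : CoLinked M) (k : ℕ) : CoLinked (kSums M k) := by
  classical
  intro a₀ ha₀ b₀ hb₀
  refine pathIn_of_descent ?_ ⟨ha₀, Set.mem_Ici.2 inf_le_left⟩ ⟨hb₀, Set.mem_Ici.2 inf_le_right⟩
  rintro a ⟨ha, hla⟩ b ⟨hb, hlb⟩ hab
  replace hla := le_inf (Set.mem_Ici.1 hla) (Set.mem_Ici.1 hlb)
  generalize a₀ ⊓ b₀ = l at hla
  have hmem {c a : σ →₀ ℕ} {p q : σ} (hc : c ∈ AddSubmonoid.closure M) (ha : a ∈ kSums M k)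
      (h : c + ev p = a + ev q) : c ∈ kSums M k := by
    rw [mem_kSums_iff two_pos hM.degree] at ha ⊢
    refine ⟨hc, ?_⟩
    have := congrArg Finsupp.degree h
    simp only [map_add, degree_ev] at this
    omega
  have ha' := (mem_kSums_iff two_pos hM.degree).1 ha
  have hb' := (mem_kSums_iff two_pos hM.degree).1 hb
  obtain ⟨p, q, hp, hq, ⟨c, hc, h⟩ | ⟨c, hc, h⟩⟩ |
    ⟨p, p', x, q, q', z, hp, hp', hq, hq', hpx, hqz, w, hw, u, hu, w', hw', u', hu', r, hr,
      hae, h, h'⟩ :=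
    hM.exchange_or_trails ha'.1 hb'.1 hab (ha'.2.trans hb'.2.symm)
  · have hcN : c ∈ kSums M k ∩ Set.Ici l :=
      ⟨hmem hc ha h, hla.trans (mem_Icc_of_move hp hq h).1⟩
    exact ⟨c, hcN, .inl ⟨.single hcN ⟨p, q, h⟩, degree_sub_lt_of_move_left hp hq h⟩⟩
  · have hcN : c ∈ kSums M k ∩ Set.Ici l :=
      ⟨hmem hc hb h, hla.trans (inf_comm a b ▸ (mem_Icc_of_move hq hp h).1)⟩
    exact ⟨c, hcN, .inr ⟨.single ⟨hb, hla.trans inf_le_right⟩ ⟨p, q, h.symm⟩,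
      degree_sub_lt_of_move_right hp hq h⟩⟩
  · obtain ⟨c, hc⟩ : ∃ c, c = u + (u' + r) := ⟨_, rfl⟩
    have hcA : c ∈ AddSubmonoid.closure M := hc ▸ add_mem hu (add_mem hu' hr)
    have hac : a = c + (ev p + ev p') := by
      calc a = (w + ev x) + ev p + (u' + r) := by rw [hae]; abel
        _ = _ := by rw [← h, hc]; abel
    have hdc : c.degree + 2 = k * 2 := by
      rw [← ha'.2, hac]
      simp
    have hlc : l ≤ c := by
      refine hla.trans fun i => ?_
      simp only [hac, Finsupp.inf_apply, Finsupp.add_apply, ev_apply] at hp hp' ⊢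
      grind
    have hN (e : σ →₀ ℕ) (he : c + e ∈ AddSubmonoid.closure M) (hd : e.degree = 2) :
        c + e ∈ kSums M k ∩ Set.Ici l := by
      refine ⟨(mem_kSums_iff two_pos hM.degree).2 ⟨he, ?_⟩, le_add_of_le_left hlc⟩
      rw [map_add, hd, hdc]
    have hedge : ∀ e ∈ M, c + e ∈ kSums M k ∩ Set.Ici l := fun e he =>
      hN e (add_mem hcA (AddSubmonoid.subset_closure he)) (hM.degree e he)
    have hend : c + (ev q + ev q') ∈ kSums M k ∩ Set.Ici l := by
      refine hN _ ?_ (by simp)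
      have : c + (ev q + ev q') = u + w' + (ev q + ev z) + r := by
        calc _ = u + (u' + ev q') + ev q + r := by rw [hc]; abel
          _ = _ := by rw [h']; abel
      rw [this]
      exact add_mem (add_mem (add_mem hu hw') (AddSubmonoid.subset_closure hqz)) hr
    refine ⟨_, hend, .inl ⟨?_, ?_⟩⟩
    · have h1 : PathIn (kSums M k ∩ Set.Ici l) a (c + (ev p + ev x)) :=
        .single (hedge _ hpx) ⟨p', x, by rw [hac]; abel⟩
      have h2 : PathIn (kSums M k ∩ Set.Ici l) (c + (ev p + ev x)) (c + (ev q + ev z)) := by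
        refine (hco _ hpx _ hqz).map (N := M ∩ Set.Ici _) (fun e => c + e) ⟨hpx, Set.mem_Ici.2 inf_le_left⟩
          (fun e he => hedge e he.1) ?_
        rintro e - e' - ⟨s, t, hst⟩
        exact ⟨s, t, by rw [add_assoc, hst, add_assoc]⟩
      exact (h1.trans h2).trans (.single hend ⟨z, q', by abel⟩)
    · have : a - b = (c + (ev q + ev q') - b) + (ev p + ev p') := by
        ext i
        simp only [hac, Finsupp.add_apply, Finsupp.tsub_apply, ev_apply] at hp hp' hq hq' ⊢
        grind
      rw [this, map_add, map_add, degree_ev, degree_ev]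
      omega

/-! ### Square-free vectors in at most five variables -/

theorem exists_eq_ev_of_degree_eq_one {σ : Type*} {a : σ →₀ ℕ} (h : a.degree = 1) :
    ∃ x, a = ev x := by
  have : a ∈ Set.range (fun x : σ => Finsupp.single x 1) := by
    rw [Finsupp.range_single_one]
    exact h
  obtain ⟨x, rfl⟩ := this
  exact ⟨x, rfl⟩

theorem exists_eq_ev_add_ev {σ : Type*} {a : σ →₀ ℕ} (ha : ∀ i, a i ≤ 1)
    (h : a.degree = 2) : ∃ x y, x ≠ y ∧ a = ev x + ev y := by
  classical
  obtain ⟨b, hb, hb1⟩ := Finsupp.exists_le_degree_eq a 1 (by omega)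
  obtain ⟨c, rfl⟩ := exists_add_of_le hb
  rw [map_add] at h
  obtain ⟨x, rfl⟩ := exists_eq_ev_of_degree_eq_one hb1
  obtain ⟨y, rfl⟩ := exists_eq_ev_of_degree_eq_one (a := c) (by omega)
  refine ⟨x, y, ?_, rfl⟩
  rintro rfl
  simpa [ev_apply] using ha x

/-- Powers preserve linkedness for square-free vectors of equal degree in at most five variables. -/
theorem linked_kSums_of_linked {n : ℕ} (hn : n ≤ 5) {M : Set (Fin n →₀ ℕ)} {d : ℕ}
    (hsq : ∀ m ∈ M, ∀ i, m i ≤ 1) (hdeg : ∀ m ∈ M, m.degree = d) (hM : Linked M)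
    {k : ℕ} (hk : 1 ≤ k) : Linked (kSums M k) := by
  obtain ⟨t, ht⟩ : ∃ t : Fin n →₀ ℕ, ∀ i, t i = 1 :=
    ⟨Finsupp.equivFunOnFinite.symm fun _ => 1, fun _ => rfl⟩
  have htd : t.degree = n := by simp [Finsupp.degree_eq_sum, ht]
  have hMt : ∀ m ∈ M, m ≤ t := fun m hm i => ht i ▸ hsq m hm i
  rcases M.eq_empty_or_nonempty with rfl | ⟨m₀, hm₀⟩
  · rw [kSums_empty hk]
    exact linked_of_subsingleton Set.subsingleton_empty
  have hdn : d ≤ n := by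
    exact (hdeg m₀ hm₀).symm.trans_le ((Finsupp.degree_mono (hMt m₀ hm₀)).trans htd.le)
  have hzero {N : Set (Fin n →₀ ℕ)} (hN : ∀ m ∈ N, m.degree = 0) : N.Subsingleton := by
    intro a ha b hb
    rw [(Finsupp.degree_eq_zero_iff a).1 (hN a ha), (Finsupp.degree_eq_zero_iff b).1 (hN b hb)]
  have hlow : d = 0 ∨ d = 1 ∨ d = 2 → Linked (kSums M k) := by
    rintro (rfl | rfl | rfl)
    · exact linked_of_subsingleton (kSums_subsingleton (hzero hdeg) k)
    · exact (hasExchange_kSums_of_variables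
        (fun m hm => exists_eq_ev_of_degree_eq_one (hdeg m hm)) k).linked
    · have hE : IsEdgeSet M := fun m hm => exists_eq_ev_add_ev (hsq m hm) (hdeg m hm)
      exact (hE.hasExchange_kSums (hE.isGapFree_of_linked hM) k).linked
  have hle : ∀ m ∈ complement t M, m ≤ t := fun m hm => le_of_mem_complement hm
  have hcodeg : ∀ m ∈ complement t M, m.degree + d = n := by
    rintro m ⟨m', hm', h⟩
    rw [← hdeg m' hm', ← map_add, h, htd]
  have hcok : CoLinked (kSums (complement t M) k) → Linked (kSums M k) := by
    intro h
    have := h.complement (fun m hm => le_of_mem_kSums hle hm)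
    rwa [← kSums_complement hle, complement_complement hMt] at this
  have hhigh : n - d = 0 ∨ n - d = 1 ∨ n - d = 2 → Linked (kSums M k) := by
    intro h
    refine hcok ?_
    rcases h with h | h | h
    · exact fun a ha b hb => .of_subsingleton (kSums_subsingleton (hzero fun m hm => by
        have := hcodeg m hm
        omega) k) ha hb
    · refine (hasExchange_kSums_of_variables
        (fun m hm => exists_eq_ev_of_degree_eq_one ?_) k).coLinked
      have := hcodeg m hm
      omega
    · have hE : IsEdgeSet (complement t M) := by
        refine fun m hm => exists_eq_ev_add_ev (fun i => ht i ▸ hle m hm i) ?_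
        have := hcodeg m hm
        omega
      exact hE.coLinked_kSums (hM.complement hMt) k
  -- The bound on the number of variables enters here: `d ≥ 3` leaves `n - d ≤ 2`.
  by_cases hd : d ≤ 2
  · exact hlow (by omega)
  · exact hhigh (by omega)

/-! ### Multihomogeneous vectors -/

theorem linearMap_apply_eq_sum {R W : Type*} [CommRing R] [AddCommGroup W] [Module R W] {m : ℕ}
    (f : (Fin m → R) →ₗ[R] W) (v : Fin m → R) : f v = ∑ b, v b • f (Pi.single b 1) := by
  conv_lhs => rw [← Finset.univ_sum_single v, map_sum]
  refine Finset.sum_congr rfl fun b _ => ?_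
  rw [← map_smul]
  congr 1
  ext1 i
  by_cases h : i = b
  · subst h; simp
  · simp [h]

theorem eq_monomial_of_support {σ K : Type*} [CommSemiring K] {p : MvPolynomial σ K} {a : σ →₀ ℕ}
    (h : ∀ e ∈ p.support, e = a) : p = monomial a (coeff a p) := by
  classical
  ext e
  rw [coeff_monomial]
  split_ifs with he
  · rw [he]
  · by_contra hne
    exact he (h e (mem_support_iff.2 hne)).symm

/-- A component of a multihomogeneous vector is a term of the complementary multidegree. -/
theorem IsMultihomogeneous.eq_monomial {K : Type*} [Field K] {n m : ℕ} {δ : Fin m → (Fin n →₀ ℕ)}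
    {a : Fin n →₀ ℕ} {v : Fin m → MvPolynomial (Fin n) K} (h : IsMultihomogeneous δ a v)
    (b : Fin m) : v b = monomial (a - δ b) (coeff (a - δ b) (v b)) :=
  eq_monomial_of_support fun e he => by rw [← h b e he, add_tsub_cancel_right]

theorem IsMultihomogeneous.le {K : Type*} [Field K] {n m : ℕ} {δ : Fin m → (Fin n →₀ ℕ)}
    {a : Fin n →₀ ℕ} {v : Fin m → MvPolynomial (Fin n) K} (h : IsMultihomogeneous δ a v)
    {b : Fin m} (hb : v b ≠ 0) : δ b ≤ a := by
  obtain ⟨e, he⟩ := support_nonempty.2 hb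
  exact h b e he ▸ le_add_self

/-- Each of the two arises from `g` by removing at most one variable. Hence generators occurring in
a common linear syzygy are neighbours. -/
theorem eq_or_unitStep_of_le {σ : Type*} {c c' g : σ →₀ ℕ} (hcc' : c.degree = c'.degree)
    (hc : c ≤ g) (hc' : c' ≤ g) (hg : g.degree ≤ c.degree + 1) : c = c' ∨ UnitStep c c' := by
  obtain ⟨r, rfl⟩ := exists_add_of_le hc
  obtain ⟨r', hr'⟩ := exists_add_of_le hc'
  have h := congrArg Finsupp.degree hr'
  rw [map_add] at hg
  rw [map_add, map_add] at h
  by_cases h0 : r.degree = 0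
  · left
    have h0' : r'.degree = 0 := by omega
    rw [Finsupp.degree_eq_zero_iff] at h0 h0'
    simpa [h0, h0'] using hr'
  · right
    obtain ⟨q, rfl⟩ := exists_eq_ev_of_degree_eq_one (a := r) (by omega)
    obtain ⟨p, rfl⟩ := exists_eq_ev_of_degree_eq_one (a := r') (by omega)
    exact ⟨p, q, hr'.symm⟩

theorem eq_of_le_of_degree_le {σ : Type*} {a b : σ →₀ ℕ} (h : a ≤ b)
    (hd : b.degree ≤ a.degree) : a = b := by
  by_contra hne
  obtain ⟨p, hp⟩ := exists_lt_of_degree_le (Ne.symm hne) (Finsupp.degree_mono h)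
  obtain ⟨c, rfl⟩ := exists_add_of_le h
  rw [map_add] at hd
  have := (Finsupp.degree_eq_zero_iff c).1 (by omega)
  simp [this] at hne

/-! ### Linear syzygies force linkedness -/

theorem MinimalFreeResolution.aug_mem {K : Type*} [Field K] {n : ℕ}
    {I : Ideal (MvPolynomial (Fin n) K)} (F : MinimalFreeResolution I)
    (v : Fin (F.rank 0) → MvPolynomial (Fin n) K) : F.aug v ∈ I :=
  F.range_aug.le (LinearMap.mem_range_self F.aug v)

/-- A basis vector with zero image would be a syzygy with constant entry one, against minimality. -/
theorem MinimalFreeResolution.exists_aug_eq {K : Type*} [Field K] {n : ℕ}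
    {I : Ideal (MvPolynomial (Fin n) K)} (F : MinimalFreeResolution I) (b : Fin (F.rank 0)) :
    ∃ γ : K, γ ≠ 0 ∧ F.aug (Pi.single b 1) = monomial (F.deg 0 b) γ := by
  have h := eq_monomial_of_support (F.aug_homogeneous b)
  refine ⟨_, fun h0 => ?_, h⟩
  rw [h0, monomial_zero, ← LinearMap.mem_ker, ← F.exact_zero] at h
  obtain ⟨v, hv⟩ := h
  have := F.minimal 0 v b
  rw [hv] at this
  simp at this

/-- The multidegrees of the generators of the equigenerated ideal spanned by the monomials in `M`
are the elements of `M`. -/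
theorem MinimalFreeResolution.exists_deg_eq {K : Type*} [Field K] {n : ℕ}
    {M : Set (Fin n →₀ ℕ)} {D : ℕ} (hM : ∀ m ∈ M, m.degree = D)
    (F : MinimalFreeResolution (Ideal.span ((fun m => monomial m (1 : K)) '' M)))
    {u : Fin n →₀ ℕ} (hu : u ∈ M) : ∃ b, F.deg 0 b = u := by
  classical
  have hmem : monomial u (1 : K) ∈ LinearMap.range F.aug := by
    rw [F.range_aug]
    exact Ideal.subset_span ⟨u, hu, rfl⟩
  obtain ⟨v, hv⟩ := hmem
  rw [linearMap_apply_eq_sum] at hv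
  have h1 := congrArg (coeff u) hv
  rw [coeff_sum, coeff_monomial, if_pos rfl] at h1
  obtain ⟨b, -, hb⟩ := Finset.exists_ne_zero_of_sum_ne_zero (h1.trans_ne one_ne_zero)
  obtain ⟨γ, hγ, hbγ⟩ := F.exists_aug_eq b
  rw [hbγ, smul_eq_mul, coeff_mul_monomial'] at hb
  have hle : F.deg 0 b ≤ u := by
    by_contra h
    simp [h] at hb
  have hI : monomial (F.deg 0 b) γ ∈ Ideal.span ((fun m => monomial m (1 : K)) '' M) := by
    rw [← hbγ]
    exact F.aug_mem _
  rw [mem_ideal_span_monomial_image] at hI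
  obtain ⟨m, hm, hmb⟩ := hI (F.deg 0 b) (by simp [hγ])
  refine ⟨b, eq_of_le_of_degree_le hle ?_⟩
  rw [hM u hu, ← hM m hm]
  exact Finsupp.degree_mono hmb

/-- If an equigenerated monomial ideal has linear first syzygies, then its generators are
linked. -/
theorem MinimalFreeResolution.linked {K : Type*} [Field K] {n : ℕ}
    {M : Set (Fin n →₀ ℕ)} {D : ℕ} (hM : ∀ m ∈ M, m.degree = D)
    (F : MinimalFreeResolution (Ideal.span ((fun m => monomial m (1 : K)) '' M)))
    (h0 : ∀ b, (F.deg 0 b).degree ≤ D) (h1 : ∀ b, (F.deg 1 b).degree ≤ D + 1) : Linked M := by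
  classical
  choose γ hγ haug using F.exists_aug_eq
  have hdegM : ∀ b, F.deg 0 b ∈ M := by
    intro b
    have hI : F.aug (Pi.single b 1) ∈ Ideal.span ((fun m => monomial m (1 : K)) '' M) :=
      F.aug_mem _
    rw [haug, mem_ideal_span_monomial_image] at hI
    obtain ⟨m, hm, hmb⟩ := hI (F.deg 0 b) (by simp [hγ])
    rwa [← eq_of_le_of_degree_le hmb ((h0 b).trans (hM m hm).ge)]
  intro u hu v hv
  obtain ⟨bu, hbu⟩ := F.exists_deg_eq hM hu
  obtain ⟨bv, hbv⟩ := F.exists_deg_eq hM hv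
  by_contra hcon
  let S : Finset (Fin (F.rank 0)) :=
    Finset.univ.filter fun b => PathIn (M ∩ Set.Iic (u ⊔ v)) u (F.deg 0 b)
  have hS : ∀ b, b ∈ S ↔ PathIn (M ∩ Set.Iic (u ⊔ v)) u (F.deg 0 b) := fun b => by simp [S]
  -- The augmentation restricted to the generators reachable from `u`: it kills what linear syzygies
  -- contribute in multidegree `u ⊔ v`, but not the syzygy between `u` and `v`.
  let f : (Fin (F.rank 0) → MvPolynomial (Fin n) K) →ₗ[MvPolynomial (Fin n) K]
      MvPolynomial (Fin n) K :=
    ∑ b ∈ S, (LinearMap.proj b).smulRight (F.aug (Pi.single b 1))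
  have hf : ∀ y, f y = ∑ b ∈ S, y b * monomial (F.deg 0 b) (γ b) := by
    intro y
    simp [f, haug]
  have haugd : ∀ y, F.aug (F.d 0 y) = 0 := by
    intro y
    rw [← LinearMap.mem_ker, ← F.exact_zero]
    exact ⟨y, rfl⟩
  have hvanish : ∀ y, coeff (u ⊔ v) (f (F.d 0 y)) = 0 := by
    intro y
    rw [linearMap_apply_eq_sum (F.d 0) y, map_sum, coeff_sum]
    refine Finset.sum_eq_zero fun c _ => ?_
    rw [map_smul, smul_eq_mul]
    have hhom := F.d_homogeneous 0 c
    -- Below the join, a linear syzygy involves only reachable generators or none, so `f` acts on it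
    -- as the augmentation or as zero. Otherwise its multidegree does not divide `u ⊔ v`.
    by_cases hg : F.deg 1 c ≤ u ⊔ v
    · have : f (F.d 0 (Pi.single c 1)) = 0 := by
        by_cases hex : ∃ b ∈ S, F.d 0 (Pi.single c 1) b ≠ 0
        · obtain ⟨b, hbS, hb⟩ := hex
          have hall : ∀ b', F.d 0 (Pi.single c 1) b' ≠ 0 → b' ∈ S := by
            intro b' hb'
            rw [hS] at hbS ⊢
            obtain h | h := eq_or_unitStep_of_le
              ((hM _ (hdegM b)).trans (hM _ (hdegM b')).symm) (hhom.le hb) (hhom.le hb')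
              ((h1 c).trans_eq (by rw [hM _ (hdegM b)]))
            · rwa [← h]
            · exact hbS.trans (.single ⟨hdegM b', (hhom.le hb').trans hg⟩ h)
          rw [hf, ← haugd (Pi.single c 1), linearMap_apply_eq_sum F.aug]
          simp only [smul_eq_mul, haug]
          refine Finset.sum_subset (Finset.subset_univ S) fun b' _ hb' => ?_
          rw [not_not.1 (mt (hall b') hb'), zero_mul]
        · push Not at hex
          rw [hf]
          exact Finset.sum_eq_zero fun b hb => by rw [hex b hb, zero_mul]
      rw [this, mul_zero, coeff_zero]
    · rw [hf, Finset.mul_sum, coeff_sum]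
      refine Finset.sum_eq_zero fun b _ => ?_
      by_cases hb : F.d 0 (Pi.single c 1) b = 0
      · simp [hb]
      · rw [hhom.eq_monomial b, monomial_mul, tsub_add_cancel_of_le (hhom.le hb),
          coeff_mul_monomial', if_neg hg]
  have hbuS : bu ∈ S := (hS _).2 (hbu ▸ .refl)
  have hbvS : bv ∉ S := fun h => hcon (hbv ▸ (hS _).1 h)
  have hne : bu ≠ bv := fun h => hbvS (h ▸ hbuS)
  let y : Fin (F.rank 0) → MvPolynomial (Fin n) K :=
    monomial (u ⊔ v - u) (γ bv) • Pi.single bu 1 - monomial (u ⊔ v - v) (γ bu) • Pi.single bv 1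
  have hy : y ∈ LinearMap.range (F.d 0) := by
    rw [F.exact_zero, LinearMap.mem_ker, map_sub, map_smul, map_smul, haug, haug, smul_eq_mul,
      smul_eq_mul, monomial_mul, monomial_mul, hbu, hbv, tsub_add_cancel_of_le le_sup_left,
      tsub_add_cancel_of_le le_sup_right, mul_comm, sub_self]
  obtain ⟨s, hs⟩ := hy
  have := hvanish s
  rw [hs, hf, Finset.sum_eq_single_of_mem bu hbuS] at this
  · simp [y, hne, monomial_mul, hbu, hγ, tsub_add_cancel_of_le (le_sup_left : u ≤ u ⊔ v)] at this
  · intro b hb hbne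
    have : b ≠ bv := fun h => hbvS (h ▸ hb)
    simp [y, this, hbne]

/-! ### Betti numbers and multigraded components -/

theorem MinimalFreeResolution.gradedBetti_eq_zero_iff {K : Type*} [Field K] {n : ℕ}
    {I : Ideal (MvPolynomial (Fin n) K)} (F : MinimalFreeResolution I) (i j : ℕ) :
    F.gradedBetti i j = 0 ↔ ∀ b, (F.deg i b).degree ≠ j := by
  rw [gradedBetti, Finset.sum_eq_zero_iff]
  simp only [multigradedBetti, Finset.card_eq_zero, Finset.filter_eq_empty_iff,
    Finset.mem_univ, true_imp_iff, Finset.mem_finsuppAntidiag, Finset.subset_univ, and_true]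
  constructor
  · intro h b hb
    exact h (F.deg i b) (by rw [← hb, Finsupp.degree_eq_sum]) rfl
  · rintro h _ ha b rfl
    exact h b (by rw [← ha, Finsupp.degree_eq_sum])

/-- The component of multidegree `a` of a vector of `⨁_b S(-δ b)`. -/
noncomputable def component {K : Type*} [Field K] {n m : ℕ} (δ : Fin m → (Fin n →₀ ℕ))
    (a : Fin n →₀ ℕ) (v : Fin m → MvPolynomial (Fin n) K) : Fin m → MvPolynomial (Fin n) K :=
  open Classical in
  fun b => if δ b ≤ a then monomial (a - δ b) (coeff (a - δ b) (v b)) else 0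

theorem component_isMultihomogeneous {K : Type*} [Field K] {n m : ℕ} (δ : Fin m → (Fin n →₀ ℕ))
    (a : Fin n →₀ ℕ) (v : Fin m → MvPolynomial (Fin n) K) :
    IsMultihomogeneous δ a (component δ a v) := by
  classical
  intro b e he
  rw [component] at he
  split_ifs at he with h
  · rw [Finset.mem_singleton.1 (support_monomial_subset he), tsub_add_cancel_of_le h]
  · simp at he

theorem component_sum {K : Type*} [Field K] {n m : ℕ} {ι : Type*} (δ : Fin m → (Fin n →₀ ℕ))
    (a : Fin n →₀ ℕ) (s : Finset ι) (v : ι → Fin m → MvPolynomial (Fin n) K) :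
    component δ a (∑ i ∈ s, v i) = ∑ i ∈ s, component δ a (v i) := by
  ext1 b
  simp only [component, Finset.sum_apply]
  split_ifs
  · rw [coeff_sum, map_sum]
  · simp

theorem component_zero {K : Type*} [Field K] {n m : ℕ} (δ : Fin m → (Fin n →₀ ℕ))
    (a : Fin n →₀ ℕ) : component δ a (0 : Fin m → MvPolynomial (Fin n) K) = 0 := by
  ext1 b
  simp [component]

theorem IsMultihomogeneous.component_smul {K : Type*} [Field K] {n m : ℕ}
    {δ : Fin m → (Fin n →₀ ℕ)} {a' : Fin n →₀ ℕ} {v : Fin m → MvPolynomial (Fin n) K}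
    (hv : IsMultihomogeneous δ a' v) (a : Fin n →₀ ℕ) (p : MvPolynomial (Fin n) K)
    [Decidable (a' ≤ a)] :
    component δ a (p • v) =
      if a' ≤ a then monomial (a - a') (coeff (a - a') p) • v else 0 := by
  classical
  ext1 b
  by_cases hb : v b = 0
  · split_ifs <;> simp [component, hb]
  have hba := hv.le hb
  rw [component, Pi.smul_apply, smul_eq_mul, hv.eq_monomial b, coeff_mul_monomial']
  by_cases ha : a' ≤ a
  · have h1 : a' - δ b ≤ a - δ b := tsub_le_tsub_right ha _
    have h2 : a - δ b - (a' - δ b) = a - a' := tsub_tsub_tsub_cancel_right hba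
    rw [if_pos (hba.trans ha), if_pos h1, if_pos ha, h2, Pi.smul_apply, hv.eq_monomial b,
      smul_eq_mul, monomial_mul]
    congr 1
    rw [tsub_add_tsub_cancel ha hba]
    rw [coeff_monomial, if_pos rfl]
  · rw [if_neg ha]
    split_ifs with h1 h2
    · refine absurd ?_ ha
      have := add_le_add_left h2 (δ b)
      rwa [tsub_add_cancel_of_le hba, tsub_add_cancel_of_le h1] at this
    · simp
    · rfl

theorem sum_component {K : Type*} [Field K] {n m : ℕ} (δ : Fin m → (Fin n →₀ ℕ))
    (v : Fin m → MvPolynomial (Fin n) K) :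
    ∃ T : Finset (Fin n →₀ ℕ), v = ∑ a ∈ T, component δ a v := by
  classical
  refine ⟨Finset.univ.biUnion fun b => (v b).support.image (· + δ b), ?_⟩
  ext1 b
  ext e
  rw [Finset.sum_apply, coeff_sum, Finset.sum_eq_single (e + δ b)]
  · simp [component]
  · intro a _ ha
    rw [component]
    split_ifs with h
    · rw [coeff_monomial, if_neg]
      rintro rfl
      exact ha (tsub_add_cancel_of_le h).symm
    · simp
  · intro h
    have : coeff e (v b) = 0 := by
      by_contra hne
      exact h (Finset.mem_biUnion.2 ⟨b, Finset.mem_univ b,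
        Finset.mem_image_of_mem _ (mem_support_iff.2 hne)⟩)
    simp [component, this]

/-- A multigraded map commutes with taking components. -/
theorem map_component {K : Type*} [Field K] {n m r : ℕ} {δ : Fin m → (Fin n →₀ ℕ)}
    {δ' : Fin r → (Fin n →₀ ℕ)} {φ : (Fin r → MvPolynomial (Fin n) K) →ₗ[MvPolynomial (Fin n) K]
      (Fin m → MvPolynomial (Fin n) K)}
    (hφ : ∀ c, IsMultihomogeneous δ (δ' c) (φ (Pi.single c 1))) (a : Fin n →₀ ℕ)
    (v : Fin r → MvPolynomial (Fin n) K) :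
    φ (component δ' a v) = component δ a (φ v) := by
  classical
  rw [linearMap_apply_eq_sum φ v, component_sum, linearMap_apply_eq_sum φ]
  refine Finset.sum_congr rfl fun c _ => ?_
  rw [(hφ c).component_smul, component]
  split_ifs
  · rfl
  · rw [zero_smul]

/-- A submodule of `⨁_b S(-δ b)` is multigraded if it is spanned by multihomogeneous vectors. -/
def IsMultigraded {K : Type*} [Field K] {n m : ℕ} (δ : Fin m → (Fin n →₀ ℕ))
    (N : Submodule (MvPolynomial (Fin n) K) (Fin m → MvPolynomial (Fin n) K)) : Prop :=
  N ≤ Submodule.span _ {v | v ∈ N ∧ ∃ a, IsMultihomogeneous δ a v}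

theorem isMultigraded_ker {K : Type*} [Field K] {n m r : ℕ} {δ : Fin m → (Fin n →₀ ℕ)}
    {δ' : Fin r → (Fin n →₀ ℕ)} {φ : (Fin r → MvPolynomial (Fin n) K) →ₗ[MvPolynomial (Fin n) K]
      (Fin m → MvPolynomial (Fin n) K)}
    (hφ : ∀ c, IsMultihomogeneous δ (δ' c) (φ (Pi.single c 1))) :
    IsMultigraded δ' (LinearMap.ker φ) := by
  intro v hv
  obtain ⟨T, hT⟩ := sum_component δ' v
  rw [hT]
  refine Submodule.sum_mem _ fun a _ => Submodule.subset_span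
    ⟨?_, a, component_isMultihomogeneous _ _ _⟩
  rw [LinearMap.mem_ker, map_component hφ, LinearMap.mem_ker.1 hv, component_zero]

/-! ### Construction of minimal free resolutions -/

/-- Any set of multihomogeneous vectors contains a finite minimal generating system of its span. -/
theorem exists_minimal_generators {K : Type*} [Field K] {n m : ℕ} {δ : Fin m → (Fin n →₀ ℕ)}
    {P : (Fin n →₀ ℕ) → Prop} {G : Set (Fin m → MvPolynomial (Fin n) K)}
    (hG : ∀ g ∈ G, ∃ a, P a ∧ IsMultihomogeneous δ a g) :
    ∃ (r : ℕ) (δ' : Fin r → (Fin n →₀ ℕ)) (g : Fin r → Fin m → MvPolynomial (Fin n) K),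
      (∀ c, P (δ' c)) ∧ (∀ c, IsMultihomogeneous δ (δ' c) (g c)) ∧
      Submodule.span (MvPolynomial (Fin n) K) (Set.range g) = Submodule.span _ G ∧
      ∀ s : Fin r → MvPolynomial (Fin n) K, ∑ c, s c • g c = 0 → ∀ c, constantCoeff (s c) = 0 := by
  classical
  have hex : ∃ k, ∃ T : Finset (Fin m → MvPolynomial (Fin n) K), ↑T ⊆ G ∧
      Submodule.span (MvPolynomial (Fin n) K) (T : Set (Fin m → MvPolynomial (Fin n) K)) =
        Submodule.span _ G ∧ T.card = k := by
    obtain ⟨T, hT, hspan⟩ := (Submodule.fg_span_iff_fg_span_finset_subset G).1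
      (IsNoetherian.noetherian (Submodule.span (MvPolynomial (Fin n) K) G))
    exact ⟨_, T, hT, hspan.symm, rfl⟩
  obtain ⟨T, hTG, hspan, hcard⟩ := Nat.find_spec hex
  let g : Fin T.card → Fin m → MvPolynomial (Fin n) K := fun c => T.equivFin.symm c
  have hgT : ∀ c, g c ∈ T := fun c => (T.equivFin.symm c).2
  have hginj : Function.Injective g := Subtype.val_injective.comp T.equivFin.symm.injective
  have hrange : Set.range g = T := by
    ext v
    constructor
    · rintro ⟨c, rfl⟩
      exact hgT c
    · intro hv
      exact ⟨T.equivFin ⟨v, hv⟩, by simp [g]⟩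
  choose δ' hP hδ' using fun c => hG (g c) (hTG (hgT c))
  refine ⟨T.card, δ', g, hP, hδ', by rw [hrange, hspan], fun s hs c₀ => ?_⟩
  by_contra hκ
  rw [constantCoeff_eq] at hκ
  -- In multidegree `δ' c₀` the coefficient of `g c₀` becomes the constant term of `s c₀`, a unit of
  -- `K`, so `g c₀` would be redundant in a generating set of least cardinality.
  have h1 := congrArg (component δ (δ' c₀)) hs
  rw [component_sum, component_zero, ← Finset.add_sum_erase _ _ (Finset.mem_univ c₀)] at h1
  simp only [(hδ' _).component_smul] at h1
  rw [if_pos le_rfl, tsub_self] at h1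
  have hmem : g c₀ ∈ Submodule.span (MvPolynomial (Fin n) K)
      (T.erase (g c₀) : Set (Fin m → MvPolynomial (Fin n) K)) := by
    have hsum : ∑ c ∈ Finset.univ.erase c₀, (if δ' c ≤ δ' c₀ then
        monomial (δ' c₀ - δ' c) (coeff (δ' c₀ - δ' c) (s c)) • g c else 0) ∈
          Submodule.span (MvPolynomial (Fin n) K)
            (T.erase (g c₀) : Set (Fin m → MvPolynomial (Fin n) K)) := by
      refine Submodule.sum_mem _ fun c hc => ?_
      split_ifs
      · refine Submodule.smul_mem _ _ (Submodule.subset_span ?_)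
        exact Finset.mem_erase.2 ⟨fun h => Finset.ne_of_mem_erase hc (hginj h), hgT c⟩
      · exact Submodule.zero_mem _
    have hterm := Submodule.neg_mem _ hsum
    rw [← eq_neg_of_add_eq_zero_left h1] at hterm
    have h2 := Submodule.smul_mem _ (C (coeff 0 (s c₀))⁻¹) hterm
    rwa [smul_smul, ← C_apply, ← C_mul, inv_mul_cancel₀ hκ, C_1, one_smul] at h2
  refine Nat.find_min hex (m := (T.erase (g c₀)).card) ?_ ⟨T.erase (g c₀),
    (Finset.coe_subset.2 (Finset.erase_subset _ _)).trans hTG, ?_, rfl⟩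
  · rw [← hcard]
    exact Finset.card_erase_lt_of_mem (hgT c₀)
  · rw [← hspan]
    refine le_antisymm (Submodule.span_mono (Finset.coe_subset.2 (Finset.erase_subset _ _))) ?_
    rw [Submodule.span_le]
    intro v hv
    by_cases h : v = g c₀
    · rw [h]; exact hmem
    · exact Submodule.subset_span (Finset.mem_erase.2 ⟨h, hv⟩)

/-- A stage of the construction of a minimal free resolution: a multigraded free module together
with the multigraded submodule that the next free module has to cover. -/
structure Stage (K : Type*) [Field K] (n : ℕ) where
  rank : ℕ
  deg : Fin rank → (Fin n →₀ ℕ)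
  sub : Submodule (MvPolynomial (Fin n) K) (Fin rank → MvPolynomial (Fin n) K)
  graded : IsMultigraded deg sub
  small : ∀ v ∈ sub, ∀ b, constantCoeff (v b) = 0

theorem Stage.exists_next_of_generators {K : Type*} [Field K] {n : ℕ} (S : Stage K n)
    {P : (Fin n →₀ ℕ) → Prop} {G : Set (Fin S.rank → MvPolynomial (Fin n) K)}
    (hG : ∀ g ∈ G, ∃ a, P a ∧ IsMultihomogeneous S.deg a g)
    (hspan : Submodule.span (MvPolynomial (Fin n) K) G = S.sub) :
    ∃ (T : Stage K n) (φ : (Fin T.rank → MvPolynomial (Fin n) K) →ₗ[MvPolynomial (Fin n) K]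
      (Fin S.rank → MvPolynomial (Fin n) K)),
      LinearMap.range φ = S.sub ∧ LinearMap.ker φ = T.sub ∧
      (∀ c, IsMultihomogeneous S.deg (T.deg c) (φ (Pi.single c 1))) ∧ ∀ c, P (T.deg c) := by
  classical
  obtain ⟨r, δ', g, hP, hδ', hg, hmin⟩ := exists_minimal_generators hG
  have hsingle : ∀ c, Fintype.linearCombination (MvPolynomial (Fin n) K) g (Pi.single c 1) = g c :=
    fun c => by simp
  have hhom : ∀ c, IsMultihomogeneous S.deg (δ' c)
      (Fintype.linearCombination (MvPolynomial (Fin n) K) g (Pi.single c 1)) :=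
    fun c => by rw [hsingle]; exact hδ' c
  refine ⟨⟨r, δ', LinearMap.ker (Fintype.linearCombination (MvPolynomial (Fin n) K) g),
    isMultigraded_ker hhom, fun v hv b => hmin v ?_ b⟩, Fintype.linearCombination _ g, ?_, rfl,
    hhom, hP⟩
  · rwa [LinearMap.mem_ker, Fintype.linearCombination_apply] at hv
  · rw [Fintype.range_linearCombination, hg, hspan]

/-- Generators are taken within the least degree bound that suffices, so that one choice of the next
stage obeys every valid bound `B`. -/
theorem Stage.exists_next {K : Type*} [Field K] {n : ℕ} (S : Stage K n) :
    ∃ (T : Stage K n) (φ : (Fin T.rank → MvPolynomial (Fin n) K) →ₗ[MvPolynomial (Fin n) K]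
      (Fin S.rank → MvPolynomial (Fin n) K)),
      LinearMap.range φ = S.sub ∧ LinearMap.ker φ = T.sub ∧
      (∀ c, IsMultihomogeneous S.deg (T.deg c) (φ (Pi.single c 1))) ∧
      ∀ B, S.sub ≤ Submodule.span _
        {v | v ∈ S.sub ∧ ∃ a : Fin n →₀ ℕ, a.degree ≤ B ∧ IsMultihomogeneous S.deg a v} →
        ∀ c, (T.deg c).degree ≤ B := by
  classical
  by_cases h : ∃ B, S.sub ≤ Submodule.span _
      {v | v ∈ S.sub ∧ ∃ a : Fin n →₀ ℕ, a.degree ≤ B ∧ IsMultihomogeneous S.deg a v}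
  · obtain ⟨T, φ, h1, h2, h3, h4⟩ := S.exists_next_of_generators
      (P := fun a => a.degree ≤ Nat.find h) (fun g hg => hg.2)
      (le_antisymm (Submodule.span_le.2 fun v hv => hv.1) (Nat.find_spec h))
    exact ⟨T, φ, h1, h2, h3, fun B hB c => (h4 c).trans (Nat.find_min' h hB)⟩
  · obtain ⟨T, φ, h1, h2, h3, -⟩ := S.exists_next_of_generators
      (P := fun _ => True) (fun g hg => hg.2.imp fun _ ha => ⟨trivial, ha⟩)
      (le_antisymm (Submodule.span_le.2 fun v hv => hv.1) S.graded)
    exact ⟨T, φ, h1, h2, h3, fun B hB => absurd ⟨B, hB⟩ h⟩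

/-- The next stage. -/
noncomputable def Stage.next {K : Type*} [Field K] {n : ℕ} (S : Stage K n) : Stage K n :=
  S.exists_next.choose

/-- The map from the next stage. -/
noncomputable def Stage.map {K : Type*} [Field K] {n : ℕ} (S : Stage K n) :
    (Fin S.next.rank → MvPolynomial (Fin n) K) →ₗ[MvPolynomial (Fin n) K]
      (Fin S.rank → MvPolynomial (Fin n) K) :=
  S.exists_next.choose_spec.choose

theorem Stage.range_map {K : Type*} [Field K] {n : ℕ} (S : Stage K n) :
    LinearMap.range S.map = S.sub :=
  S.exists_next.choose_spec.choose_spec.1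

theorem Stage.ker_map {K : Type*} [Field K] {n : ℕ} (S : Stage K n) :
    LinearMap.ker S.map = S.next.sub :=
  S.exists_next.choose_spec.choose_spec.2.1

theorem Stage.map_homogeneous {K : Type*} [Field K] {n : ℕ} (S : Stage K n) (c : Fin S.next.rank) :
    IsMultihomogeneous S.deg (S.next.deg c) (S.map (Pi.single c 1)) :=
  S.exists_next.choose_spec.choose_spec.2.2.1 c

theorem Stage.degree_next_le {K : Type*} [Field K] {n : ℕ} (S : Stage K n) {B : ℕ}
    (hB : S.sub ≤ Submodule.span _
      {v | v ∈ S.sub ∧ ∃ a : Fin n →₀ ℕ, a.degree ≤ B ∧ IsMultihomogeneous S.deg a v})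
    (c : Fin S.next.rank) : (S.next.deg c).degree ≤ B :=
  S.exists_next.choose_spec.choose_spec.2.2.2 B hB c

/-- The stages following a given one. -/
noncomputable def Stage.iterate {K : Type*} [Field K] {n : ℕ} (S : Stage K n) : ℕ → Stage K n
  | 0 => S
  | i + 1 => (S.iterate i).next

/-- The minimal free resolution obtained from a minimal multigraded presentation of an ideal. -/
noncomputable def Stage.resolution {K : Type*} [Field K] {n : ℕ}
    {I : Ideal (MvPolynomial (Fin n) K)} (S : Stage K n)
    (aug : (Fin S.rank → MvPolynomial (Fin n) K) →ₗ[MvPolynomial (Fin n) K]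
      MvPolynomial (Fin n) K)
    (hrange : LinearMap.range aug = I) (hker : LinearMap.ker aug = S.sub)
    (haug : ∀ b, ∀ e ∈ (aug (Pi.single b 1)).support, e = S.deg b) : MinimalFreeResolution I where
  rank i := (S.iterate i).rank
  deg i := (S.iterate i).deg
  aug := aug
  d i := (S.iterate i).map
  range_aug := hrange
  exact_zero := S.range_map.trans hker.symm
  exact_succ i := (S.iterate (i + 1)).range_map.trans (S.iterate i).ker_map.symm
  aug_homogeneous := haug
  d_homogeneous i b := (S.iterate i).map_homogeneous b
  minimal i v b := (S.iterate i).small _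
    ((S.iterate i).range_map.le (LinearMap.mem_range_self _ v)) b

/-! ### Linked generators have linear syzygies -/

theorem IsMultihomogeneous.sub {K : Type*} [Field K] {n m : ℕ} {δ : Fin m → (Fin n →₀ ℕ)}
    {a : Fin n →₀ ℕ} {v w : Fin m → MvPolynomial (Fin n) K} (hv : IsMultihomogeneous δ a v)
    (hw : IsMultihomogeneous δ a w) : IsMultihomogeneous δ a (v - w) := by
  classical
  intro b e he
  rcases Finset.mem_union.1 (support_sub _ _ _ he) with h | h
  · exact hv b e h
  · exact hw b e h

theorem isMultihomogeneous_monomial_smul_single {K : Type*} [Field K] {n m : ℕ}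
    {δ : Fin m → (Fin n →₀ ℕ)} {a : Fin n →₀ ℕ} {b : Fin m} (h : δ b ≤ a) (κ : K) :
    IsMultihomogeneous δ a
      (monomial (a - δ b) κ • (Pi.single b 1 : Fin m → MvPolynomial (Fin n) K)) := by
  classical
  intro c e he
  by_cases hc : c = b
  · subst hc
    rw [Pi.smul_apply, Pi.single_eq_same, smul_eq_mul, mul_one] at he
    rw [Finset.mem_singleton.1 (support_monomial_subset he), tsub_add_cancel_of_le h]
  · simp [hc] at he

/-- For distinct neighbours, `c + ev q` is their join. -/
theorem UnitStep.add_le {σ : Type*} {c c' a : σ →₀ ℕ} {p q : σ} (h : c' + ev p = c + ev q)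
    (hne : c ≠ c') (hc : c ≤ a) (hc' : c' ≤ a) : c + ev q ≤ a := by
  classical
  have hpq : p ≠ q := by
    rintro rfl
    exact hne (add_right_cancel h).symm
  intro i
  have h1 := DFunLike.congr_fun h i
  have h2 := hc i
  have h3 := hc' i
  simp only [Finsupp.add_apply, ev_apply] at h1 ⊢
  grind

/-- If the monomials `x^{w b}` of degree `D` are linked, then the syzygies of degree at most `D + 1`
generate all of their syzygies. -/
theorem ker_le_span_linear {K : Type*} [Field K] {n r D : ℕ} {w : Fin r → (Fin n →₀ ℕ)}
    (hw : Function.Injective w) (hD : ∀ b, (w b).degree = D) (hlink : Linked (Set.range w))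
    {N : Submodule (MvPolynomial (Fin n) K) (Fin r → MvPolynomial (Fin n) K)}
    (hN : N = LinearMap.ker (Fintype.linearCombination (MvPolynomial (Fin n) K)
      fun b => monomial (w b) (1 : K)))
    (hgr : IsMultigraded w N) :
    N ≤ Submodule.span _
      {v | v ∈ N ∧ ∃ a : Fin n →₀ ℕ, a.degree ≤ D + 1 ∧ IsMultihomogeneous w a v} := by
  classical
  have hmemN : ∀ v, v ∈ N ↔ ∑ b, v b * monomial (w b) (1 : K) = 0 := by
    intro v
    rw [hN, LinearMap.mem_ker, Fintype.linearCombination_apply]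
    rfl
  set L := Submodule.span (MvPolynomial (Fin n) K)
    {v | v ∈ N ∧ ∃ a : Fin n →₀ ℕ, a.degree ≤ D + 1 ∧ IsMultihomogeneous w a v} with hL
  let E : (Fin n →₀ ℕ) → Fin r → Fin r → MvPolynomial (Fin n) K :=
    fun a b => monomial (a - w b) (1 : K) • Pi.single b 1
  have hEsum : ∀ a b, w b ≤ a → ∑ i, E a b i * monomial (w i) (1 : K) = monomial a 1 := by
    intro a b hba
    rw [Finset.sum_eq_single b]
    · simp [E, monomial_mul, tsub_add_cancel_of_le hba]
    · intro i _ hi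
      simp [E, hi]
    · simp
  have hstep : ∀ a b b', w b ≤ a → w b' ≤ a → UnitStep (w b) (w b') → E a b - E a b' ∈ L := by
    rintro a b b' hb hb' ⟨p, q, hpq⟩
    by_cases hbb : w b = w b'
    · rw [hw hbb, sub_self]
      exact zero_mem _
    have hga := UnitStep.add_le hpq hbb hb hb'
    -- The lcm of the two monomials has degree `D + 1`, so the difference is a multiple of a linear
    -- syzygy.
    obtain ⟨g, hg⟩ : ∃ g, g = w b + ev q := ⟨_, rfl⟩
    have hbg : w b ≤ g := hg ▸ le_self_add
    have hbg' : w b' ≤ g := by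
      rw [hg, ← hpq]
      exact le_self_add
    rw [← hg] at hga
    have hEg : ∀ i, w i ≤ g → E a i = monomial (a - g) (1 : K) • E g i := by
      intro i hi
      rw [← smul_assoc, smul_eq_mul, monomial_mul, one_mul, tsub_add_tsub_cancel hga hi]
    rw [hEg b hbg, hEg b' hbg', ← smul_sub]
    refine Submodule.smul_mem _ _ (Submodule.subset_span ⟨?_, g, ?_, ?_⟩)
    · rw [hmemN]
      simp only [Pi.sub_apply, sub_mul, Finset.sum_sub_distrib]
      rw [hEsum g b hbg, hEsum g b' hbg', sub_self]
    · rw [hg, map_add, hD, degree_ev]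
    · exact (isMultihomogeneous_monomial_smul_single hbg 1).sub
        (isMultihomogeneous_monomial_smul_single hbg' 1)
  have hpath : ∀ a b b', w b ≤ a → w b' ≤ a → E a b - E a b' ∈ L := by
    intro a b b' hb hb'
    suffices h : ∀ c, PathIn (Set.range w ∩ Set.Iic (w b ⊔ w b')) (w b) c →
        ∃ i, w i = c ∧ c ≤ a ∧ E a b - E a i ∈ L by
      obtain ⟨i, hi, -, hiL⟩ := h _ (hlink _ ⟨b, rfl⟩ _ ⟨b', rfl⟩)
      rwa [← hw hi]
    intro c hc
    induction hc with
    | refl => exact ⟨b, rfl, hb, by rw [sub_self]; exact zero_mem _⟩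
    | tail _ hs ih =>
      obtain ⟨i, rfl, hia, hiL⟩ := ih
      obtain ⟨⟨⟨j, rfl⟩, hj⟩, hs⟩ := hs
      have hja := (Set.mem_Iic.1 hj).trans (sup_le hb hb')
      refine ⟨j, rfl, hja, ?_⟩
      rw [← sub_add_sub_cancel _ (E a i)]
      exact add_mem hiL (hstep a i j hia hja hs)
  refine hgr.trans (Submodule.span_le.2 ?_)
  rintro v ⟨hv, a, hva⟩
  by_cases hv0 : v = 0
  · rw [hv0]
    exact zero_mem L
  obtain ⟨b₀, hb₀⟩ := Function.ne_iff.1 hv0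
  have hle := hva.le hb₀
  have hcoeff : ∀ b, ¬ w b ≤ a → coeff (a - w b) (v b) = 0 := by
    intro b hb
    rw [not_not.1 (mt hva.le hb), coeff_zero]
  have hsum : ∑ b, coeff (a - w b) (v b) = 0 := by
    have h1 := congrArg (coeff a) ((hmemN v).1 hv)
    rw [coeff_sum, coeff_zero] at h1
    rw [← h1]
    refine Finset.sum_congr rfl fun b _ => ?_
    rw [coeff_mul_monomial', mul_one]
    split_ifs with hb
    · rfl
    · exact hcoeff b hb
  -- Since the coefficients sum to zero, subtracting `E a b₀` from every term changes nothing.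
  have hvE : v = ∑ b, (C (coeff (a - w b) (v b)) : MvPolynomial (Fin n) K) •
      (E a b - E a b₀) := by
    simp only [smul_sub, Finset.sum_sub_distrib]
    rw [← Finset.sum_smul, ← map_sum, hsum, map_zero, zero_smul, sub_zero]
    ext1 i
    rw [Finset.sum_apply, Finset.sum_eq_single i]
    · simp only [E, Pi.smul_apply, Pi.single_eq_same, smul_eq_mul, mul_one, C_mul_monomial]
      exact hva.eq_monomial i
    · intro b _ hb
      simp [E, hb.symm]
    · simp
  rw [SetLike.mem_coe, hvE]
  refine Submodule.sum_mem _ fun b _ => ?_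
  by_cases hb : w b ≤ a
  · exact Submodule.smul_mem _ _ (hpath a b b₀ hb hle)
  · rw [hcoeff b hb, C_0, zero_smul]
    exact zero_mem _

/-- A monomial ideal generated by linked monomials of the same degree has linear first
syzygies. -/
theorem isStepLinear_one_of_linked {K : Type*} [Field K] {n D : ℕ} {M : Set (Fin n →₀ ℕ)}
    (hM : ∀ m ∈ M, m.degree = D) (hlink : Linked M) :
    IsStepLinear (Ideal.span ((fun m => monomial m (1 : K)) '' M)) 1 := by
  classical
  refine ⟨D, ⟨_, ?_, rfl⟩, ?_⟩
  · rintro _ ⟨m, hm, rfl⟩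
    refine isHomogeneous_monomial 1 ?_
    exact hM m hm
  obtain ⟨r, w, hw, rfl⟩ := ((Finsupp.finite_of_degree_eq D).subset hM).fin_param
  have hD : ∀ b, (w b).degree = D := fun b => hM _ ⟨b, rfl⟩
  let aug := Fintype.linearCombination (MvPolynomial (Fin n) K) fun b => monomial (w b) (1 : K)
  have haug : ∀ b, aug (Pi.single b 1) = monomial (w b) 1 := fun b => by simp [aug]
  have hgr : IsMultigraded w (LinearMap.ker aug) := by
    -- The target `S` is viewed as a free module of rank one generated in multidegree zero.
    have h := isMultigraded_ker (δ := fun _ : Fin 1 => 0) (δ' := w)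
      (φ := LinearMap.pi fun _ => aug) (fun c b e he => by
        rw [LinearMap.pi_apply, haug] at he
        rw [add_zero, Finset.mem_singleton.1 (support_monomial_subset he)])
    rwa [LinearMap.ker_pi, iInf_const] at h
  let S : Stage K n :=
    { rank := r
      deg := w
      sub := LinearMap.ker aug
      graded := hgr
      small := by
        intro v hv b
        rw [LinearMap.mem_ker, Fintype.linearCombination_apply] at hv
        -- Distinct monomials of equal degree do not divide one another, so only the constant term
        -- of `v b` contributes here.
        have h1 := congrArg (coeff (w b)) hv
        rw [coeff_sum, coeff_zero, Finset.sum_eq_single b] at h1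
        · rw [constantCoeff_eq]
          simpa [coeff_mul_monomial'] using h1
        · intro c _ hc
          rw [smul_eq_mul, coeff_mul_monomial', if_neg]
          intro hle
          exact hc (hw (eq_of_le_of_degree_le hle (by rw [hD, hD])))
        · simp }
  refine ⟨S.resolution aug ?_ rfl ?_, ?_⟩
  · rw [Fintype.range_linearCombination, ← Set.range_comp]
    rfl
  · intro b e he
    rw [haug] at he
    exact Finset.mem_singleton.1 (support_monomial_subset he)
  · intro i hi j hj
    rw [MinimalFreeResolution.gradedBetti_eq_zero_iff]
    intro b
    have hi' : i = 0 ∨ i = 1 := by omega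
    rcases hi' with rfl | rfl
    · have : (S.deg b).degree = D := hD b
      exact fun h => by
        have h' : (S.deg b).degree = j := h
        omega
    · have := S.degree_next_le (ker_le_span_linear hw hD hlink rfl hgr) b
      exact fun h => by
        have h' : (S.next.deg b).degree = j := h
        omega

/-! ### The index, powers and square-free generators -/

theorem one_lt_index_iff {K : Type*} [Field K] {n : ℕ} (I : Ideal (MvPolynomial (Fin n) K)) :
    1 < index I ↔ ∃ r, 1 ≤ r ∧ IsStepLinear I r := by
  rw [index]
  constructor
  · intro h
    by_contra! hcon
    have : sSup ((fun r : ℕ => (r : ℕ∞)) '' {r : ℕ | IsStepLinear I r}) ≤ 0 := by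
      refine sSup_le ?_
      rintro _ ⟨r, hr, rfl⟩
      have : r = 0 := by
        by_contra h0
        exact hcon r (by omega) hr
      simp [this]
    rw [nonpos_iff_eq_zero.1 this, zero_add] at h
    exact lt_irrefl _ h
  · rintro ⟨r, hr, hI⟩
    have h1 : (1 : ℕ∞) ≤ sSup ((fun r : ℕ => (r : ℕ∞)) '' {r : ℕ | IsStepLinear I r}) :=
      le_trans (Nat.one_le_cast.2 hr) (le_sSup ⟨r, hI, rfl⟩)
    calc (1 : ℕ∞) < 1 + 1 := by norm_num
      _ ≤ _ := by gcongr

theorem span_monomial_pow {K : Type*} [Field K] {n : ℕ} (M : Set (Fin n →₀ ℕ)) (k : ℕ) :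
    Ideal.span ((fun m => monomial m (1 : K)) '' M) ^ k =
      Ideal.span ((fun m => monomial m (1 : K)) '' kSums M k) := by
  induction k with
  | zero => simp [kSums]
  | succ k ih =>
    rw [pow_succ, ih, Ideal.span_mul_span']
    congr 1
    ext f
    constructor
    · rintro ⟨_, ⟨a, ha, rfl⟩, _, ⟨b, hb, rfl⟩, rfl⟩
      exact ⟨a + b, ⟨a, ha, b, hb, rfl⟩, by simp [monomial_mul]⟩
    · rintro ⟨_, ⟨a, ha, b, hb, rfl⟩, rfl⟩
      exact ⟨_, ⟨a, ha, rfl⟩, _, ⟨b, hb, rfl⟩, by simp [monomial_mul]⟩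

/-- A square-free monomial ideal generated in degree `d` is generated by square-free monomials of
degree `d`. -/
theorem IsSquarefreeMonomialIdeal.exists_exponents {K : Type*} [Field K] {n d : ℕ}
    {I : Ideal (MvPolynomial (Fin n) K)} (hI : IsSquarefreeMonomialIdeal I)
    (hG : ∃ G : Set (MvPolynomial (Fin n) K), (∀ f ∈ G, f.IsHomogeneous d) ∧ I = Ideal.span G) :
    ∃ M : Set (Fin n →₀ ℕ), (∀ m ∈ M, m.degree = d) ∧ (∀ m ∈ M, ∀ i, m i ≤ 1) ∧
      I = Ideal.span ((fun m => monomial m (1 : K)) '' M) := by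
  classical
  obtain ⟨A, hA⟩ := hI
  obtain ⟨G, hGhom, hG⟩ := hG
  have hmon : I = Ideal.span ((fun m => monomial m (1 : K)) ''
      ((fun F : Finset (Fin n) => ∑ i ∈ F, ev i) '' A)) := by
    rw [hA, Set.image_image]
    simp only [monomial_sum_one]
    rfl
  have hspan : I = Ideal.span ((fun m => monomial m (1 : K)) ''
      {m | m.degree = d ∧ monomial m (1 : K) ∈ I}) := by
    refine le_antisymm ?_ (Ideal.span_le.2 ?_)
    · conv_lhs => rw [hG]
      refine Ideal.span_le.2 fun f hf => ?_
      rw [SetLike.mem_coe, mem_ideal_span_monomial_image]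
      intro e he
      have hfI : f ∈ I := hG ▸ Ideal.subset_span hf
      refine ⟨e, ⟨?_, ?_⟩, le_rfl⟩
      · have := hGhom f hf (mem_support_iff.1 he)
        rw [Finsupp.degree_eq_weight_one]
        exact this
      · rw [hmon, mem_ideal_span_monomial_image] at hfI ⊢
        intro e' he'
        rw [Finset.mem_singleton.1 (support_monomial_subset he')]
        exact hfI e he
    · rintro _ ⟨m, hm, rfl⟩
      exact hm.2
  refine ⟨_, fun m hm => hm.1, ?_, hspan⟩
  rintro m ⟨hmd, hmI⟩ i
  rw [hmon, mem_ideal_span_monomial_image] at hmI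
  obtain ⟨_, ⟨F, hF, rfl⟩, hFm⟩ := hmI m (by simp)
  have hFI : monomial (∑ i ∈ F, ev i) (1 : K) ∈ I := by
    rw [hmon]
    exact Ideal.subset_span ⟨_, ⟨F, hF, rfl⟩, rfl⟩
  rw [hspan, mem_ideal_span_monomial_image] at hFI
  obtain ⟨m', ⟨hm'd, -⟩, hm'⟩ := hFI (∑ i ∈ F, ev i) (by simp)
  -- The square-free divisor of `m` lies in `I`, hence has degree at least `d`, and so equals `m`.
  have := eq_of_le_of_degree_le hFm (by
    rw [hmd, ← hm'd]
    exact Finsupp.degree_mono hm')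
  rw [← this, Finsupp.finsetSum_apply]
  simp only [ev_apply, Finset.sum_ite_eq']
  split_ifs <;> omega

end GLIndex

theorem theorem2p6 {K : Type*} [Field K] (n : ℕ) (hn : n ≤ 5)
    (I : Ideal (MvPolynomial (Fin n) K)) (hI : GLIndex.IsSquarefreeMonomialIdeal I)
    (hindex : 1 < GLIndex.index I) (k : ℕ) (hk : 1 ≤ k) :
    1 < GLIndex.index (I ^ k) := by
  obtain ⟨r, hr, d, hG, F, hF⟩ := (GLIndex.one_lt_index_iff I).1 hindex
  obtain ⟨M, hMd, hMsq, rfl⟩ := hI.exists_exponents hG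
  have hdeg : ∀ i ≤ r, ∀ b, (F.deg i b).degree ≤ d + i := by
    intro i hi b
    by_contra! h
    exact (F.gradedBetti_eq_zero_iff i _).1 (hF i hi _ h) b rfl
  have hlink : GLIndex.Linked M := F.linked hMd (hdeg 0 (Nat.zero_le r)) (hdeg 1 hr)
  rw [GLIndex.one_lt_index_iff, GLIndex.span_monomial_pow]
  exact ⟨1, le_rfl, GLIndex.isStepLinear_one_of_linked
    (fun m hm => GLIndex.degree_of_mem_kSums hMd hm)
    (GLIndex.linked_kSums_of_linked hn hMsq hMd hlink hk)⟩
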